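/- Let $\Bbbk$ be a field, $n\ge 2$, $V$ an $n$-dimensional $\Bbbk$-vector space with basis $v_1,\dots,v_n$, and $q\in\Bbbk^\times$. For $R\in\mathrm{End}_\Bbbk(V^{\otimes 2})$ write $R(v_i\otimes v_j)=\sum_{k,l}R^{kl}_{ij}\,v_k\otimes v_l$. Let $R_q\in\mathrm{End}_\Bbbk(V^{\otimes 2})$ be the classical Yang–Baxter operator, \[ R_q(v_i\otimes v_j)=\begin{cases} q\,v_i\otimes v_i, & i=j,\\ v_i\otimes v_j, & i<j,\\ v_i\otimes v_j+(q-q^{-1})\,v_j\otimes v_i, & i>j.\end{cases} \] Let $A(R_q)$ be the bialgebra generated by $t^j_i$ $(1\le i,j\le n)$ with relations $\sum_{i,j}(R_q)^{kl}_{ij}\,t^j_ut^i_v=\sum_{i,j}(R_q)^{ij}_{vu}\,t^k_it^l_j$ for all $u,v,k,l$, comultiplication $\Delta(t^j_i)=\sum_k t^j_k\otimes t^k_i$ and counit $\varepsilon(t^j_i)=\delta^j_i$. Let $g=\sum_{s\in S_n}(-q)^{\ell(s)}\,t^{s(1)}_1\cdots t^{s(n)}_n$ be its quantum determinant, and let $H=A(R_q)[g^{-1}]$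 (isomorphic to $\mathcal O_q(\mathrm{GL}_n)$), with $g^{-1}$ group-like, $\mathbb Z$-graded by $|t^j_i|=1$, $|g^{-1}|=-n$. Let $(\phi_1,\phi_2)$ be a twisting pair of $H$, that is, a pair of algebra automorphisms of $H$ with $\Delta\phi_1=(\mathrm{id}\otimes\phi_1)\Delta$, $\Delta\phi_2=(\phi_2\otimes\mathrm{id})\Delta$ and $\varepsilon\phi_1\phi_2=\varepsilon$. Let $\sigma:H\otimes H\to\Bbbk$ be the linear map with $\sigma(x,y)=\varepsilon(x)\,\varepsilon(\phi_2^{|x|}(y))$ for homogeneous $x$ and all $y$. Then $\sigma$ is a 2-cocycle on $H$, i.e. it is convolution invertible, $\sum\sigma(x_1,y_1)\sigma(x_2y_2,z)=\sum\sigma(y_1,z_1)\sigma(x,y_2z_2)$ and $\sigma(x,1)=\sigma(1,x)=\varepsilon(x)$. Let $\sigma^{-1}$ be its convolution inverse and let $(R_q)^\sigma\in\mathrm{End}_\Bbbk(V^{\otimes 2})$ be the twisted operator \[ \big((R_q)^\sigma\big)^{kl}_{ij}=\sum_{u,v,p,r}\sigma(t^k_u,t^l_v)\,(R_q)^{uv}_{pr}\,\sigma^{-1}(t^r_j,t^p_i).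 \] Then $(R_q)^\sigma$ is a solution of the quantum Yang–Baxter equation $R^{12}R^{13}R^{23}=R^{23}R^{13}R^{12}$. Moreover, there are $n\times n$ matrices $(\alpha^i_j)$ and $(\beta^i_j)$ over $\Bbbk$ ($i$ the row, $j$ the column), inverse to each other, with $\phi_1(t^j_i)=\sum_u\alpha^u_i\,t^j_u$ and $\phi_2(t^j_i)=\sum_u\beta^j_u\,t^u_i$ for all $i,j$, such that for all $i,j,k,l$: 1. If $q=1$, then $\big((R_q)^\sigma\big)^{kl}_{ij}=\alpha^k_i\beta^l_j$. 2. If $q=-1$ and $\mathrm{char}\,\Bbbk\ne 2$, then there is a permutation $\tau\in S_n$ such that $\alpha^i_j\ne0$ if and only if $j=\tau(i)$ (so $(\alpha^i_j)$ is a generalized permutation matrix), and $\big((R_q)^\sigma\big)^{kl}_{ij}=(-1)^{\delta^k_j}\,\delta^k_{\tau^{-1}(i)}\,\delta^l_{\tau(j)}\,\alpha^k_i\,(\alpha^j_l)^{-1}$, where the right-hand side is read as $0$ if $l\ne\tau(j)$. 3. If $q\ne\pm1$, then $(\alpha^i_j)$ is diagonal, and $\big((R_q)^\sigma\big)^{kl}_{ij}=(R_q)^{kl}_{ij}\,\alpha^i_i\,(\alpha^l_l)^{-1}$.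 -/

import Mathlib

open scoped TensorProduct
namespace TwistR

/-- The coefficients of the classical Yang-Baxter operator: `rqMatrix n q (a, b) (i, j)` is the
coefficient of `v a ⊗ v b` in `R_q (v i ⊗ v j)` (see `coeffs_ybOperator`). -/
def rqMatrix {k : Type*} [Field k] (n : ℕ) (q : kˣ) :
    Matrix (Fin n × Fin n) (Fin n × Fin n) k :=
  fun c d => if d.1 = d.2 then (if c = d then (q : k) else 0)
    else (if c = d then 1 else 0) +
      (if d.2 < d.1 ∧ c = d.swap then (q : k) - ((q⁻¹ : kˣ) : k) else 0)

/-- The Faddeev-Reshetikhin-Takhtajan relations for a matrix `T` with entries in an algebra. Here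
`R (a, b) (i, j)` stands for the coefficient with upper indices `a, b` and lower indices `i, j`, and
`T j u` (row `j`, column `u`) for the generator with upper index `j` and lower index `u`. -/
def IsFRT {k : Type*} [Field k] {n : ℕ} {E : Type*} [Semiring E] [Algebra k E]
    (R : Matrix (Fin n × Fin n) (Fin n × Fin n) k) (T : Matrix (Fin n) (Fin n) E) : Prop :=
  ∀ u v a b : Fin n, ∑ i, ∑ j, R (a, b) (i, j) • (T j u * T i v) =
    ∑ i, ∑ j, R (i, j) (v, u) • (T a i * T b j)

/-- The length of a permutation, as its number of inversions. -/
def inversions {n : ℕ} (s : Equiv.Perm (Fin n)) : ℕ :=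
  (Finset.univ.filter fun p : Fin n × Fin n => p.1 < p.2 ∧ s p.2 < s p.1).card

/-- The quantum determinant of a matrix satisfying the relations of `A(R_q)`. (In terms of the
presentation of `O_q(M_n)` by `q x_{ks} x_{kv} = x_{kv} x_{ks}` for `s < v`, the matrix of generators
of `A(R_q)` satisfies these relations with `q⁻¹` in place of `q`, whence the positive exponent.) -/
def qdet {k : Type*} [Field k] {n : ℕ} {E : Type*} [Semiring E] [Algebra k E]
    (q : kˣ) (T : Matrix (Fin n) (Fin n) E) : E :=
  ∑ s : Equiv.Perm (Fin n), (-(q : k)) ^ inversions s • (List.ofFn fun i => T (s i) i).prod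

section qdet
variable {k : Type*} [Field k] {n : ℕ} (q : kˣ)

/-- Auxiliary scalars for the proof that the quantum determinant is multiplicative. -/
def coef (a : Fin n) (s : Multiset (Fin n)) : k :=
  if a ∈ s then 0 else (-(q : k)) ^ s.countP (· < a)

def weight : List (Fin n) → k
  | [] => 1
  | a :: l => coef q a (l : Multiset (Fin n)) * weight l

/-- Relations of the quantum exterior algebra. -/
structure IsQExt {E : Type*} [Ring E] [Algebra k E] (x : Fin n → E) : Prop where
  sq (v : Fin n) : x v * x v = 0
  comm (u v : Fin n) (h : v < u) : x u * x v = (-(q : k)) • (x v * x u)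

theorem IsQExt.insert {E : Type*} [Ring E] [Algebra k E] {x : Fin n → E} (hx : IsQExt q x)
    (a : Fin n) (l : List (Fin n)) (hl : l.Pairwise (· ≤ ·)) :
    x a * (l.map x).prod =
      (coef q a (l : Multiset (Fin n)) : k) • ((l.orderedInsert (· ≤ ·) a).map x).prod := by
  induction l with
  | nil => simp [coef]
  | cons b t ih =>
    have ht := (List.pairwise_cons.1 hl)
    rcases lt_trichotomy a b with h | h | h
    · have h1 : a ∉ b :: t := by
        intro hm
        rcases List.mem_cons.1 hm with h2 | h2
        · exact h.ne h2
        · exact absurd (ht.1 a h2) (not_le.2 h)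
      have h2 : List.countP (· < a) (b :: t) = 0 := by
        rw [List.countP_eq_zero]
        intro c hc
        rcases List.mem_cons.1 hc with h2 | h2
        · simp [h2, h.le]
        · simpa using h.le.trans (ht.1 c h2)
      have h3 : (coef q a ((b :: t : List (Fin n)) : Multiset (Fin n)) : k) = 1 := by
        rw [coef, if_neg (by simpa using h1), Multiset.coe_countP, h2, pow_zero]
      rw [h3]; simp [List.orderedInsert, h.le]
    · subst h
      simp [coef, ← mul_assoc, hx.sq]
    · have h3 : (coef q a ((b :: t : List (Fin n)) : Multiset (Fin n)) : k) =
          -(q : k) * coef q a (t : Multiset (Fin n)) := by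
        have : ¬ a = b := h.ne'
        simp only [coef, Multiset.mem_coe, List.mem_cons, this, false_or, Multiset.coe_countP,
          List.countP_cons, h, decide_true, if_true, pow_succ']
        split_ifs <;> simp
      rw [h3]
      simp only [List.orderedInsert, not_le.2 h, if_false, List.map_cons, List.prod_cons]
      rw [← mul_assoc, hx.comm a b h, smul_mul_assoc, mul_assoc, ih ht.2, mul_smul_comm, smul_smul]

theorem IsQExt.prod {E : Type*} [Ring E] [Algebra k E] {x : Fin n → E} (hx : IsQExt q x)
    (l : List (Fin n)) :
    (l.map x).prod = (weight q l : k) • ((l.insertionSort (· ≤ ·)).map x).prod := by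
  induction l with
  | nil => simp [weight]
  | cons a t ih =>
    have h : (coef q a (t.insertionSort (· ≤ ·) : Multiset (Fin n)) : k) =
        coef q a (t : Multiset (Fin n)) := by
      rw [Multiset.coe_eq_coe.2 (List.perm_insertionSort _ t)]
    rw [List.map_cons, List.prod_cons, ih, mul_smul_comm,
      hx.insert q a _ (List.pairwise_insertionSort _ t), h, smul_smul, weight, mul_comm]
    rfl

theorem weight_eq_zero (l : List (Fin n)) (h : ¬ l.Nodup) : (weight q l : k) = 0 := by
  induction l with
  | nil => simp at h
  | cons a t ih =>
    rw [List.nodup_cons, not_and_or, not_not] at h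
    rcases h with h | h
    · simp [weight, coef, h]
    · simp [weight, ih h]

theorem weight_ofFn {m : ℕ} (f : Fin m → Fin n) (hf : Function.Injective f) :
    (weight q (List.ofFn f) : k) = (-(q : k)) ^
      (Finset.univ.filter fun p : Fin m × Fin m => p.1 < p.2 ∧ f p.2 < f p.1).card := by
  induction m with
  | zero => simp [weight]
  | succ m ih =>
    have h0 : f 0 ∉ List.ofFn (fun i : Fin m => f i.succ) := by
      rw [List.mem_ofFn]
      rintro ⟨i, hi⟩
      exact Fin.succ_ne_zero i (hf hi)
    have h1 : List.countP (· < f 0) (List.ofFn (fun i : Fin m => f i.succ)) =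
        ∑ i : Fin m, if f i.succ < f 0 then 1 else 0 := by
      rw [List.ofFn_eq_map, List.countP_map, ← Finset.card_filter, List.countP_eq_length_filter]
      rw [← List.toFinset_card_of_nodup ((List.nodup_finRange m).filter _)]
      congr 1
      ext i; simp
    have h2 (m' : ℕ) (g : Fin m' → Fin n) :
        (Finset.univ.filter fun p : Fin m' × Fin m' => p.1 < p.2 ∧ g p.2 < g p.1).card =
        ∑ i, ∑ j, if i < j ∧ g j < g i then 1 else 0 := by
      rw [Finset.card_filter, ← Finset.univ_product_univ, Finset.sum_product]
    rw [List.ofFn_succ, weight, ih (fun i => f i.succ) (fun i j h => Fin.succ_injective _ (hf h)),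
      coef, if_neg (by simpa using h0), Multiset.coe_countP, ← pow_add, h1, h2 (m + 1) f, h2 m (fun i => f i.succ)]
    congr 1
    rw [Fin.sum_univ_succ (n := m)]
    congr 1
    · rw [Fin.sum_univ_succ]
      simp [Fin.succ_pos]
    · refine Finset.sum_congr rfl fun i _ => ?_
      rw [Fin.sum_univ_succ]
      simp

theorem sum_weight {E : Type*} [Ring E] [Algebra k E] (T : Matrix (Fin n) (Fin n) E) :
    ∑ f : Fin n → Fin n, (weight q (List.ofFn f) : k) • (List.ofFn fun i => T (f i) i).prod =
      qdet q T := by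
  unfold qdet
  symm
  apply Finset.sum_of_injOn (fun s : Equiv.Perm (Fin n) => (s : Fin n → Fin n))
  · intro s _ t _ h
    exact DFunLike.coe_injective h
  · simp
  · intro f _ hf
    have : ¬ Function.Injective f := by
      intro hi
      exact hf ⟨Equiv.ofBijective f (Finite.injective_iff_bijective.1 hi), by simp⟩
    rw [weight_eq_zero q _ (by simpa [List.nodup_ofFn] using this), zero_smul]
  · intro s _
    rw [weight_ofFn q _ s.injective]; rfl

noncomputable def creation (a : Fin n) : Module.End k (Multiset (Fin n) →₀ k) :=
  Finsupp.linearCombination k fun s => Finsupp.single (a ::ₘ s) (coef q a s)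

theorem creation_single (a : Fin n) (s : Multiset (Fin n)) (c : k) :
    creation q a (Finsupp.single s c) = Finsupp.single (a ::ₘ s) (c * coef q a s) := by
  simp [creation]

theorem isQExt_creation : IsQExt q (creation q : Fin n → Module.End k _) where
  sq v := by
    ext s : 2
    simp [creation_single, coef]
  comm u v h := by
    ext s : 2
    have h1 : ¬ u = v := h.ne'
    have h2 : ¬ v = u := h.ne
    simp only [LinearMap.comp_apply, Module.End.mul_apply, Finsupp.lsingle_apply, creation_single,
      LinearMap.smul_apply, Finsupp.smul_single, Multiset.cons_swap u v]
    congr 1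
    simp only [coef, Multiset.mem_cons, h1, h2, false_or, Multiset.countP_cons, h, h.not_gt,
      if_true, if_false, smul_eq_mul, pow_succ, add_zero]
    split_ifs <;> simp
    ring

theorem creation_prod (l : List (Fin n)) :
    (l.map (creation q)).prod (Finsupp.single 0 1) =
      Finsupp.single (l : Multiset (Fin n)) (weight q l : k) := by
  induction l with
  | nil => simp [weight]
  | cons a t ih => simp [ih, creation_single, weight, mul_comm]

/-- The coefficient of the top vector in the image of the vacuum vector. -/
noncomputable def vacuum : Module.End k (Multiset (Fin n) →₀ k) →ₗ[k] k :=
  Finsupp.lapply (Finset.univ : Finset (Fin n)).val ∘ₗ LinearMap.applyₗ (Finsupp.single 0 1)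

theorem vacuum_prod (f : Fin n → Fin n) :
    vacuum (List.ofFn fun i => creation q (f i)).prod = (weight q (List.ofFn f) : k) := by
  have : (List.ofFn fun i => creation q (f i)) = (List.ofFn f).map (creation q) := by
    rw [List.map_ofFn]; rfl
  rw [this]
  simp only [vacuum, LinearMap.comp_apply, LinearMap.applyₗ_apply_apply, creation_prod,
    Finsupp.lapply_apply]
  by_cases h : (List.ofFn f).Nodup
  · have h1 : ((List.ofFn f : List (Fin n)) : Multiset (Fin n)) = (Finset.univ : Finset (Fin n)).val := by
      rw [List.nodup_ofFn] at h
      have h2 := (Finite.injective_iff_bijective.1 h).2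
      refine (Multiset.Nodup.ext (by simpa [List.nodup_ofFn] using h) (Finset.nodup _)).2 ?_
      intro a; simpa [List.mem_ofFn] using h2 a
    rw [h1, Finsupp.single_eq_same]
  · rw [weight_eq_zero q _ h]; simp

theorem ofFn_mul {E : Type*} [Monoid E] {m : ℕ} (x y : Fin m → E)
    (h : ∀ i j, Commute (y i) (x j)) :
    (List.ofFn fun i => x i * y i).prod = (List.ofFn x).prod * (List.ofFn y).prod := by
  induction m with
  | zero => simp
  | succ m ih =>
    have h1 : Commute (y 0) (List.ofFn fun i : Fin m => x i.succ).prod := by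
      apply Commute.list_prod_right
      intro z hz
      obtain ⟨i, rfl⟩ := List.mem_ofFn.1 hz
      exact h _ _
    simp only [List.ofFn_succ, List.prod_cons]
    rw [ih _ _ fun i j => h _ _]
    simp only [mul_assoc]
    rw [← mul_assoc (y 0), h1.eq]
    simp only [mul_assoc]

theorem ofFn_sum {E : Type*} [Ring E] [Algebra k E] {m : ℕ} (x : Fin m → Fin n → E) :
    (List.ofFn fun i => ∑ b, x i b).prod =
      ∑ f : Fin m → Fin n, (List.ofFn fun i => x i (f i)).prod := by
  simpa using (MultilinearMap.mkPiAlgebraFin k m E).map_sum (g := x)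

variable {E : Type*} [Ring E] [Algebra k E]

theorem sum4 {ι M : Type*} [Fintype ι] [AddCommMonoid M] (f : ι → ι → ι → ι → M) :
    ∑ a, ∑ b, ∑ i, ∑ j, f a b i j = ∑ i, ∑ j, ∑ a, ∑ b, f a b i j := by
  have h := Finset.sum_comm (s := (Finset.univ : Finset (ι × ι)))
    (t := (Finset.univ : Finset (ι × ι))) (f := fun p r => f p.1 p.2 r.1 r.2)
  simpa only [Fintype.sum_prod_type] using h

theorem rq_sum_left (c : Fin n × Fin n) {M : Type*} [AddCommGroup M] [Module k M]
    (F : Fin n → Fin n → M) :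
    ∑ i, ∑ j, rqMatrix n q c (i, j) • F i j =
      if c.1 = c.2 then (q : k) • F c.1 c.2 else F c.1 c.2 +
        if c.1 < c.2 then ((q : k) - ((q⁻¹ : kˣ) : k)) • F c.2 c.1 else 0 := by
  rw [← Finset.sum_product']
  rw [Finset.univ_product_univ]
  obtain ⟨a, b⟩ := c
  have key : ∀ d : Fin n × Fin n, rqMatrix n q (a, b) (d.1, d.2) • F d.1 d.2 =
      (if d = (a, b) then (if a = b then (q : k) • F a b else F a b) else 0) +
      (if d = (b, a) then (if a < b then ((q : k) - ((q⁻¹ : kˣ) : k)) • F b a else 0) else 0) := by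
    rintro ⟨i, j⟩
    simp only [rqMatrix, Prod.mk.injEq, Prod.swap_prod_mk]
    by_cases h1 : i = a ∧ j = b
    · obtain ⟨rfl, rfl⟩ := h1
      by_cases h : i = j
      · subst h; simp
      · have h' : ¬ j = i := fun e => h e.symm
        simp [h, h']
    · have h1' : ¬ (a = i ∧ b = j) := fun e => h1 ⟨e.1.symm, e.2.symm⟩
      by_cases h2 : i = b ∧ j = a
      · obtain ⟨rfl, rfl⟩ := h2
        by_cases h : i = j
        · subst h; simp at h1
        · have h' : ¬ j = i := fun e => h e.symm
          simp only [h, h', if_false, and_self, if_true]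
          by_cases h3 : j < i <;> simp [h3]
      · have h2' : ¬ (a = j ∧ b = i) := fun e => h2 ⟨e.2.symm, e.1.symm⟩
        simp [h1, h2, h1', h2']
  rw [Finset.sum_congr rfl fun d _ => key d, Finset.sum_add_distrib]
  simp
  split_ifs <;> first | rfl | simp_all

theorem rq_sum_right (d : Fin n × Fin n) {M : Type*} [AddCommGroup M] [Module k M]
    (F : Fin n → Fin n → M) :
    ∑ i, ∑ j, rqMatrix n q (i, j) d • F i j =
      if d.1 = d.2 then (q : k) • F d.1 d.2 else F d.1 d.2 +
        if d.2 < d.1 then ((q : k) - ((q⁻¹ : kˣ) : k)) • F d.2 d.1 else 0 := by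
  rw [← Finset.sum_product']
  rw [Finset.univ_product_univ]
  obtain ⟨a, b⟩ := d
  have key : ∀ c : Fin n × Fin n, rqMatrix n q (c.1, c.2) (a, b) • F c.1 c.2 =
      (if c = (a, b) then (if a = b then (q : k) • F a b else F a b) else 0) +
      (if c = (b, a) then (if b < a then ((q : k) - ((q⁻¹ : kˣ) : k)) • F b a else 0) else 0) := by
    rintro ⟨i, j⟩
    simp only [rqMatrix, Prod.mk.injEq, Prod.swap_prod_mk]
    by_cases h1 : i = a ∧ j = b
    · obtain ⟨rfl, rfl⟩ := h1
      by_cases h : i = j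
      · subst h; simp
      · have h' : ¬ j = i := fun e => h e.symm
        simp [h, h']
    · by_cases h2 : i = b ∧ j = a
      · obtain ⟨rfl, rfl⟩ := h2
        by_cases h : i = j
        · subst h; simp at h1
        · have h' : ¬ j = i := fun e => h e.symm
          simp only [h, h', if_false, and_self, if_true, and_true]
          by_cases h3 : i < j <;> simp [h3]
      · simp [h1, h2]
  rw [Finset.sum_congr rfl fun d _ => key d, Finset.sum_add_distrib]
  simp
  split_ifs <;> first | rfl | simp_all


theorem IsQExt.pair {x : Fin n → E} (hx : IsQExt q x) (a b : Fin n) (h : a < b) :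
    x a * x b + ((q⁻¹ : kˣ) : k) • (x b * x a) = 0 := by
  rw [hx.comm b a h, smul_smul]
  simp

theorem IsQExt.rq_sum {x : Fin n → E} (hx : IsQExt q x) (i j : Fin n) :
    ∑ a, ∑ b, rqMatrix n q (a, b) (i, j) • (x a * x b) =
      (-((q⁻¹ : kˣ) : k)) • (x j * x i) := by
  rw [rq_sum_right q (i, j) fun a b => x a * x b]
  rcases lt_trichotomy i j with h | h | h
  · simp [h.ne, h.not_gt, hx.comm j i h, smul_smul]
  · subst h; simp [hx.sq]
  · simp only [h.ne', if_false, h, if_true, hx.comm i j h]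
    module

noncomputable def extGen (T : Matrix (Fin n) (Fin n) E) (v : Fin n) :
    E ⊗[k] Module.End k (Multiset (Fin n) →₀ k) :=
  ∑ a, T a v ⊗ₜ[k] creation q a

theorem extGen_mul (T : Matrix (Fin n) (Fin n) E) (u v : Fin n) :
    extGen q T u * extGen q T v =
      ∑ a, ∑ b, (T a u * T b v) ⊗ₜ[k] (creation q a * creation q b) := by
  simp [extGen, Finset.sum_mul_sum]

theorem isQExt_extGen (T : Matrix (Fin n) (Fin n) E) (hT : IsFRT (rqMatrix n q) T) :
    IsQExt q (extGen q T) where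
  sq v := by
    rw [extGen_mul, ← Finset.sum_product', Finset.univ_product_univ]
    have hlt : ∀ a b : Fin n, a < b → (T a v * T b v) ⊗ₜ[k] (creation q a * creation q b) +
        (T b v * T a v) ⊗ₜ[k] (creation q b * creation q a) = 0 := by
      intro a b hab
      have h := hT v v a b
      rw [rq_sum_left, rq_sum_right] at h
      simp only [hab.ne, if_false, hab, if_true] at h
      have h1 : T b v * T a v = ((q⁻¹ : kˣ) : k) • (T a v * T b v) := by
        rw [sub_smul] at h
        have h' : T b v * T a v - ((q⁻¹ : kˣ) : k) • (T a v * T b v) = 0 := by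
          rw [← sub_eq_zero] at h
          rw [← h]; abel
        exact sub_eq_zero.1 h'
      rw [h1, TensorProduct.smul_tmul, ← TensorProduct.tmul_add]
      exact (congrArg _ ((isQExt_creation q).pair q a b hab)).trans (TensorProduct.tmul_zero _ _)
    refine Finset.sum_involution (fun p _ => p.swap) ?_ ?_ ?_ ?_
    · rintro ⟨a, b⟩ _
      simp only [Prod.swap_prod_mk]
      rcases lt_trichotomy a b with h | h | h
      · exact hlt a b h
      · subst h; simp [(isQExt_creation q).sq]
      · rw [add_comm]; exact hlt b a h
    · rintro ⟨a, b⟩ _ h1 h2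
      have : b = a := (Prod.mk.inj h2).1
      subst this
      exact h1 (by simp [(isQExt_creation q).sq])
    · simp
    · simp
  comm u v h := by
    have h1 : ∀ a b, T a v * T b u = ∑ i, ∑ j, rqMatrix n q (a, b) (i, j) • (T j u * T i v) := by
      intro a b
      rw [hT u v a b, rq_sum_right]
      simp [h.ne, h.not_gt]
    have h2 : ∀ i j : Fin n, ∑ a, ∑ b, rqMatrix n q (a, b) (i, j) •
        (creation q a * creation q b) =
        (-((q⁻¹ : kˣ) : k)) • (creation q j * creation q i : Module.End k _) := by
      intro i j
      exact (isQExt_creation q).rq_sum q i j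
    have h3 : extGen q T v * extGen q T u =
        (-((q⁻¹ : kˣ) : k)) • (extGen q T u * extGen q T v) := by
      rw [extGen_mul, extGen_mul]
      calc _ = ∑ a, ∑ b, ∑ i, ∑ j, (T j u * T i v) ⊗ₜ[k]
              (rqMatrix n q (a, b) (i, j) • (creation q a * creation q b)) := by
            simp only [h1, TensorProduct.sum_tmul, TensorProduct.smul_tmul]
        _ = ∑ i, ∑ j, (T j u * T i v) ⊗ₜ[k]
              (∑ a, ∑ b, rqMatrix n q (a, b) (i, j) • (creation q a * creation q b)) := by
            simp only [TensorProduct.tmul_sum]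
            exact sum4 _
        _ = _ := by
            rw [Finset.sum_comm]
            simp only [h2, TensorProduct.tmul_smul, Finset.smul_sum]
    rw [h3, smul_smul]
    simp

noncomputable def readOff : E ⊗[k] Module.End k (Multiset (Fin n) →₀ k) →ₗ[k] E :=
  (TensorProduct.rid k E).toLinearMap ∘ₗ vacuum.lTensor E

theorem readOff_extGen (T : Matrix (Fin n) (Fin n) E) :
    readOff (List.ofFn (extGen q T)).prod = qdet q T := by
  rw [← sum_weight]
  have h : ∀ (m : ℕ) (x : Fin m → E) (y : Fin m → Module.End k (Multiset (Fin n) →₀ k)),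
      (List.ofFn fun i => x i ⊗ₜ[k] y i).prod = (List.ofFn x).prod ⊗ₜ[k] (List.ofFn y).prod := by
    intro m x y
    induction m with
    | zero => simp [Algebra.TensorProduct.one_def]
    | succ m ih => simp [List.ofFn_succ, ih]
  have h1 : extGen q T = fun i => ∑ b, T b i ⊗ₜ[k] creation q b := rfl
  rw [h1, ofFn_sum (k := k), map_sum]
  refine Finset.sum_congr rfl fun f _ => ?_
  rw [h]
  simp [readOff, vacuum_prod]

theorem qdet_mul (T U : Matrix (Fin n) (Fin n) E) (hT : IsFRT (rqMatrix n q) T)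
    (hTU : ∀ a b c d, Commute (U a b) (T c d)) :
    qdet q (T * U) = qdet q T * qdet q U := by
  have h1 : extGen q (T * U) = fun i => ∑ b, extGen q T b * (U b i ⊗ₜ[k] 1) := by
    funext i
    simp only [extGen, Matrix.mul_apply, TensorProduct.sum_tmul, Finset.sum_mul,
      Algebra.TensorProduct.tmul_mul_tmul, mul_one]
    rw [Finset.sum_comm]
  have h2 : ∀ b c d, Commute (U b c ⊗ₜ[k] (1 : Module.End k (Multiset (Fin n) →₀ k)))
      (extGen q T d) := by
    intro b c d
    refine Commute.sum_right _ _ _ fun a _ => ?_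
    simp only [Commute, SemiconjBy, Algebra.TensorProduct.tmul_mul_tmul, one_mul, mul_one,
      (hTU b c a d).eq]
  have h3 : ∀ f : Fin n → Fin n, (List.ofFn fun i => extGen q T (f i)).prod =
      (weight q (List.ofFn f) : k) • (List.ofFn (extGen q T)).prod := by
    intro f
    have hf : (List.ofFn fun i => extGen q T (f i)) = (List.ofFn f).map (extGen q T) := by
      rw [List.map_ofFn]; rfl
    rw [hf, (isQExt_extGen q T hT).prod]
    by_cases h : (List.ofFn f).Nodup
    · have h4 : (List.ofFn f).insertionSort (· ≤ ·) = List.finRange n := by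
        refine List.Perm.eq_of_pairwise' (r := (· ≤ ·)) ?_ ?_ ?_
        · exact List.pairwise_insertionSort _ _
        · exact (List.pairwise_lt_finRange n).imp le_of_lt
        · refine (List.perm_insertionSort _ _).trans ?_
          rw [List.perm_ext_iff_of_nodup h (List.nodup_finRange n)]
          rw [List.nodup_ofFn] at h
          intro a
          simpa [List.mem_ofFn] using (Finite.injective_iff_bijective.1 h).2 a
      rw [h4, List.ofFn_eq_map (f := extGen q T)]
    · rw [weight_eq_zero q _ h, zero_smul, zero_smul]
  have h5 : ∀ (z : E ⊗[k] Module.End k (Multiset (Fin n) →₀ k)) (e : E),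
      readOff (z * (e ⊗ₜ[k] 1)) = readOff z * e := by
    intro z e
    induction z with
    | zero => simp
    | add x y hx hy => rw [add_mul, map_add, hx, hy, map_add, add_mul]
    | tmul x y => simp [readOff]
  have h6 : ∀ (m : ℕ) (x : Fin m → E), (List.ofFn fun i => x i ⊗ₜ[k]
      (1 : Module.End k (Multiset (Fin n) →₀ k))).prod = (List.ofFn x).prod ⊗ₜ[k] 1 := by
    intro m x
    induction m with
    | zero => simp [Algebra.TensorProduct.one_def]
    | succ m ih => simp [List.ofFn_succ, ih]
  rw [← readOff_extGen, h1, ofFn_sum (k := k), map_sum]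
  have h7 : ∀ f : Fin n → Fin n, readOff
      (List.ofFn fun i => extGen q T (f i) * (U (f i) i ⊗ₜ[k] 1)).prod =
      qdet q T * ((weight q (List.ofFn f) : k) • (List.ofFn fun i => U (f i) i).prod) := by
    intro f
    rw [ofFn_mul _ _ fun i j => h2 _ _ _, h3, h6, smul_mul_assoc, map_smul, h5, readOff_extGen,
      mul_smul_comm]
  rw [Finset.sum_congr rfl fun f _ => h7 f, ← Finset.mul_sum, sum_weight]

theorem IsFRT.mul {R : Matrix (Fin n × Fin n) (Fin n × Fin n) k} {T U : Matrix (Fin n) (Fin n) E}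
    (hT : IsFRT R T) (hU : IsFRT R U) (hTU : ∀ a b c d, Commute (U a b) (T c d)) :
    IsFRT R (T * U) := by
  have e : ∀ a b c d : Fin n, (T * U) a b * (T * U) c d =
      ∑ s, ∑ t, (T a s * T c t) * (U s b * U t d) := by
    intro a b c d
    simp only [Matrix.mul_apply, Finset.sum_mul_sum]
    refine Finset.sum_congr rfl fun s _ => Finset.sum_congr rfl fun t _ => ?_
    rw [mul_assoc, ← mul_assoc (U s b), (hTU s b c t).eq]
    simp only [mul_assoc]
  intro u v a b
  simp only [e]
  calc ∑ i, ∑ j, R (a, b) (i, j) • ∑ s, ∑ t, T j s * T i t * (U s u * U t v)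
      = ∑ s, ∑ t, (∑ i, ∑ j, R (a, b) (i, j) • (T j s * T i t)) * (U s u * U t v) := by
        simp only [Finset.sum_mul, Finset.smul_sum, smul_mul_assoc]
        exact sum4 _
    _ = ∑ s, ∑ t, (∑ i, ∑ j, R (i, j) (t, s) • (T a i * T b j)) * (U s u * U t v) := by
        simp only [hT _ _ a b]
    _ = ∑ i, ∑ j, (T a i * T b j) * (∑ t, ∑ s, R (i, j) (t, s) • (U s u * U t v)) := by
        rw [Finset.sum_comm]
        simp only [Finset.sum_mul, Finset.mul_sum, mul_smul_comm, smul_mul_assoc]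
        exact sum4 _
    _ = ∑ i, ∑ j, (T a i * T b j) * (∑ s, ∑ t, R (s, t) (v, u) • (U i s * U j t)) := by
        simp only [hU _ _ _ _]
    _ = _ := by
        simp only [Finset.mul_sum, mul_smul_comm, Finset.smul_sum]
        exact sum4 _
end qdet

section QGL
variable (k : Type*) [Field k] (n : ℕ) (q : kˣ)

/-- Defining relations of `A(R_q)[g⁻¹]`: the relations of `A(R_q)` between the generators
`some (j, i)` (upper index `j`, lower index `i`), and `g g⁻¹ = g⁻¹ g = 1`, where `g` is the quantum
determinant and `none` is the generator `g⁻¹`. -/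
inductive QuantumGLRel : FreeAlgebra k (Option (Fin n × Fin n)) →
    FreeAlgebra k (Option (Fin n × Fin n)) → Prop
  | frt (u v a b : Fin n) : QuantumGLRel
      (∑ i, ∑ j, rqMatrix n q (a, b) (i, j) •
        (FreeAlgebra.ι k (some (j, u)) * FreeAlgebra.ι k (some (i, v))))
      (∑ i, ∑ j, rqMatrix n q (i, j) (v, u) •
        (FreeAlgebra.ι k (some (a, i)) * FreeAlgebra.ι k (some (b, j))))
  | mul_inv : QuantumGLRel
      (qdet q (Matrix.of fun j i => FreeAlgebra.ι k (some (j, i))) * FreeAlgebra.ι k none) 1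
  | inv_mul : QuantumGLRel
      (FreeAlgebra.ι k none * qdet q (Matrix.of fun j i => FreeAlgebra.ι k (some (j, i)))) 1

/-- The algebra `A(R_q)[g⁻¹] = O_q(GL_n)`: the algebra `A(R_q)` with an inverse of the quantum
determinant `g` adjoined. -/
def QuantumGL : Type _ := RingQuot (QuantumGLRel k n q)

namespace QuantumGL

noncomputable instance : Ring (QuantumGL k n q) :=
  inferInstanceAs (Ring (RingQuot (QuantumGLRel k n q)))

noncomputable instance : Algebra k (QuantumGL k n q) :=
  inferInstanceAs (Algebra k (RingQuot (QuantumGLRel k n q)))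

noncomputable def mk : FreeAlgebra k (Option (Fin n × Fin n)) →ₐ[k] QuantumGL k n q :=
  RingQuot.mkAlgHom k (QuantumGLRel k n q)

/-- The generators of `A(R_q)[g⁻¹]`. -/
noncomputable def gen (x : Option (Fin n × Fin n)) : QuantumGL k n q :=
  mk k n q (FreeAlgebra.ι k x)

/-- The matrix of generators of `A(R_q)`: `t k n q j i` has upper index `j` and lower index `i`. -/
noncomputable def t : Matrix (Fin n) (Fin n) (QuantumGL k n q) :=
  Matrix.of fun j i => gen k n q (some (j, i))

/-- The inverse of the quantum determinant. -/
noncomputable def gInv : QuantumGL k n q := gen k n q none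

variable {k n q}

theorem map_qdet {E F : Type*} [Semiring E] [Algebra k E] [Semiring F] [Algebra k F] (f : E →ₐ[k] F)
    (T : Matrix (Fin n) (Fin n) E) : f (qdet q T) = qdet q (T.map f) := by
  simp only [qdet, map_sum, map_smul, map_list_prod, List.map_ofFn]
  rfl

theorem mk_eq {x y : FreeAlgebra k (Option (Fin n × Fin n))} (h : QuantumGLRel k n q x y) :
    mk k n q x = mk k n q y := RingQuot.mkAlgHom_rel k h

theorem isFRT_t : IsFRT (rqMatrix n q) (t k n q) := by
  intro u v a b
  have h := mk_eq (QuantumGLRel.frt (q := q) u v a b)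
  simp only [map_sum, map_smul, map_mul] at h
  exact h

theorem qdet_mul_gInv : qdet q (t k n q) * gInv k n q = 1 := by
  have h := mk_eq (k := k) (n := n) (QuantumGLRel.mul_inv (q := q))
  rw [map_mul, map_qdet, map_one] at h
  exact h

theorem gInv_mul_qdet : gInv k n q * qdet q (t k n q) = 1 := by
  have h := mk_eq (k := k) (n := n) (QuantumGLRel.inv_mul (q := q))
  rw [map_mul, map_qdet, map_one] at h
  exact h

section lift
variable {E : Type*} [Semiring E] [Algebra k E]

noncomputable def lift (T : Matrix (Fin n) (Fin n) E) (d : E) (hT : IsFRT (rqMatrix n q) T)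
    (h₁ : qdet q T * d = 1) (h₂ : d * qdet q T = 1) : QuantumGL k n q →ₐ[k] E :=
  RingQuot.liftAlgHom k (s := QuantumGLRel k n q)
    ⟨FreeAlgebra.lift k fun x => x.elim d fun p => T p.1 p.2, by
      intro x y h
      cases h with
      | frt u v a b => simpa using hT u v a b
      | mul_inv =>
        have e : (Matrix.of fun j i => FreeAlgebra.ι k (some (j, i))).map
            (FreeAlgebra.lift k fun x : Option (Fin n × Fin n) => x.elim d fun p => T p.1 p.2) =
            T := by
          ext i j; simp
        rw [map_mul, map_qdet, map_one, FreeAlgebra.lift_ι_apply, e]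
        exact h₁
      | inv_mul =>
        have e : (Matrix.of fun j i => FreeAlgebra.ι k (some (j, i))).map
            (FreeAlgebra.lift k fun x : Option (Fin n × Fin n) => x.elim d fun p => T p.1 p.2) =
            T := by
          ext i j; simp
        rw [map_mul, map_qdet, map_one, FreeAlgebra.lift_ι_apply, e]
        exact h₂⟩

variable (T : Matrix (Fin n) (Fin n) E) (d : E) (hT : IsFRT (rqMatrix n q) T)
    (h₁ : qdet q T * d = 1) (h₂ : d * qdet q T = 1)

theorem lift_gen (x : Option (Fin n × Fin n)) :
    lift T d hT h₁ h₂ (gen k n q x) = x.elim d fun p => T p.1 p.2 := by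
  unfold lift gen mk
  erw [RingQuot.liftAlgHom_mkAlgHom_apply]
  simp

theorem lift_t (i j : Fin n) : lift T d hT h₁ h₂ (t k n q i j) = T i j :=
  lift_gen T d hT h₁ h₂ _

theorem lift_gInv : lift T d hT h₁ h₂ (gInv k n q) = d := lift_gen T d hT h₁ h₂ _

theorem hom_ext' {E : Type*} [Semiring E] [Algebra k E] {f f' : QuantumGL k n q →ₐ[k] E}
    (h : ∀ x, f (gen k n q x) = f' (gen k n q x)) : f = f' := by
  refine RingQuot.ringQuot_ext' k f f' ?_
  refine FreeAlgebra.hom_ext ?_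
  funext x
  exact h x

theorem hom_ext {E : Type*} [Semiring E] [Algebra k E] {f f' : QuantumGL k n q →ₐ[k] E}
    (h : ∀ i j, f (t k n q i j) = f' (t k n q i j)) (h' : f (gInv k n q) = f' (gInv k n q)) :
    f = f' :=
  hom_ext' fun x => match x with
    | none => h'
    | some p => h p.1 p.2

end lift

section map
variable {R : Matrix (Fin n × Fin n) (Fin n × Fin n) k} {E F : Type*}
  [Semiring E] [Algebra k E] [Semiring F] [Algebra k F] (f : E →ₐ[k] F)
  {T : Matrix (Fin n) (Fin n) E}

theorem map_frt_left (u v a b : Fin n) :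
    f (∑ i, ∑ j, R (a, b) (i, j) • (T j u * T i v)) =
      ∑ i, ∑ j, R (a, b) (i, j) • (T.map f j u * T.map f i v) := by
  simp only [map_sum, map_smul, map_mul]
  rfl

theorem map_frt_right (u v a b : Fin n) :
    f (∑ i, ∑ j, R (i, j) (v, u) • (T a i * T b j)) =
      ∑ i, ∑ j, R (i, j) (v, u) • (T.map f a i * T.map f b j) := by
  simp only [map_sum, map_smul, map_mul]
  rfl

theorem _root_.TwistR.IsFRT.map (hT : IsFRT R T) : IsFRT R (T.map f) := by
  intro u v a b
  rw [← map_frt_left, ← map_frt_right, hT u v a b]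

end map

noncomputable def comulMatrix : Matrix (Fin n) (Fin n) (QuantumGL k n q ⊗[k] QuantumGL k n q) :=
  (t k n q).map (Algebra.TensorProduct.includeLeft (R := k) (S := k)) *
    (t k n q).map (Algebra.TensorProduct.includeRight (R := k))

theorem comulMatrix_apply (j i : Fin n) :
    comulMatrix (k := k) (q := q) j i = ∑ l, t k n q j l ⊗ₜ[k] t k n q l i := by
  simp [comulMatrix, Matrix.mul_apply]

theorem commute_incl (a b c d : Fin n) :
    Commute ((t k n q).map (Algebra.TensorProduct.includeRight (R := k)
        (A := QuantumGL k n q)) a b)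
      ((t k n q).map (Algebra.TensorProduct.includeLeft (R := k) (S := k)
        (B := QuantumGL k n q)) c d) := by
  simp [Commute, SemiconjBy]

theorem isFRT_comulMatrix : IsFRT (rqMatrix n q) (comulMatrix (k := k) (q := q)) :=
  (isFRT_t.map _).mul (isFRT_t.map _) commute_incl

theorem qdet_comulMatrix : qdet q (comulMatrix (k := k) (n := n) (q := q)) =
    qdet q (t k n q) ⊗ₜ[k] qdet q (t k n q) := by
  rw [comulMatrix, qdet_mul q _ _ (isFRT_t.map _) commute_incl, ← map_qdet, ← map_qdet]
  simp

noncomputable def comulHom : QuantumGL k n q →ₐ[k] QuantumGL k n q ⊗[k] QuantumGL k n q :=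
  lift comulMatrix (gInv k n q ⊗ₜ[k] gInv k n q) isFRT_comulMatrix
    (by rw [qdet_comulMatrix, Algebra.TensorProduct.tmul_mul_tmul, qdet_mul_gInv,
          Algebra.TensorProduct.one_def])
    (by rw [qdet_comulMatrix, Algebra.TensorProduct.tmul_mul_tmul, gInv_mul_qdet,
          Algebra.TensorProduct.one_def])

theorem isFRT_one (R : Matrix (Fin n × Fin n) (Fin n × Fin n) k) :
    IsFRT R (1 : Matrix (Fin n) (Fin n) k) := by
  intro u v a b
  simp [Matrix.one_apply]

theorem qdet_one : qdet q (1 : Matrix (Fin n) (Fin n) k) = 1 := by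
  unfold qdet
  rw [Finset.sum_eq_single 1]
  · have : inversions (1 : Equiv.Perm (Fin n)) = 0 := by
      rw [inversions, Finset.card_eq_zero, Finset.filter_eq_empty_iff]
      rintro p _ ⟨h1, h2⟩
      exact absurd h1 (not_lt.2 h2.le)
    rw [this, pow_zero, one_smul, List.prod_ofFn]
    exact Finset.prod_eq_one fun i _ => Matrix.one_apply_eq i
  · intro s _ hs
    have : ∃ i, s i ≠ i := by
      by_contra h
      push Not at h
      exact hs (Equiv.ext h)
    obtain ⟨i, hi⟩ := this
    rw [List.prod_ofFn, Finset.prod_eq_zero (Finset.mem_univ i), smul_zero]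
    exact Matrix.one_apply_ne hi
  · simp

noncomputable def counitHom : QuantumGL k n q →ₐ[k] k :=
  lift 1 1 (isFRT_one _) (by rw [qdet_one, one_mul]) (by rw [qdet_one, one_mul])

/-- The bialgebra structure with `Δ(t_i^j) = ∑ l, t_l^j ⊗ t_i^l`, `ε(t_i^j) = δ_i^j`,
`Δ(g⁻¹) = g⁻¹ ⊗ g⁻¹` and `ε(g⁻¹) = 1`. -/
noncomputable instance : Bialgebra k (QuantumGL k n q) :=
  Bialgebra.ofAlgHom comulHom counitHom
    (by
      refine hom_ext (fun i j => ?_) ?_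
      · simp only [AlgHom.comp_apply, comulHom, lift_t, comulMatrix_apply, map_sum,
          Algebra.TensorProduct.map_tmul, TensorProduct.sum_tmul, TensorProduct.tmul_sum]
        rw [Finset.sum_comm]
        simp
      · simp [AlgHom.comp_apply, comulHom, lift_gInv])
    (by
      refine hom_ext (fun i j => ?_) ?_
      · simp [AlgHom.comp_apply, comulHom, counitHom, lift_t, comulMatrix_apply,
          Matrix.one_apply, TensorProduct.ite_tmul]
      · simp [AlgHom.comp_apply, comulHom, counitHom, lift_gInv])
    (by
      refine hom_ext (fun i j => ?_) ?_
      · simp [AlgHom.comp_apply, comulHom, counitHom, lift_t, comulMatrix_apply,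
          Matrix.one_apply, TensorProduct.tmul_ite]
      · simp [AlgHom.comp_apply, comulHom, counitHom, lift_gInv])

theorem comul_t (j i : Fin n) : Coalgebra.comul (R := k) (t k n q j i) =
    ∑ l, t k n q j l ⊗ₜ[k] t k n q l i :=
  (lift_t _ _ _ _ _ j i).trans (comulMatrix_apply j i)

theorem comul_gInv : Coalgebra.comul (R := k) (gInv k n q) = gInv k n q ⊗ₜ[k] gInv k n q :=
  lift_gInv _ _ _ _ _

theorem counit_t (j i : Fin n) : Coalgebra.counit (R := k) (t k n q j i) =
    if j = i then 1 else 0 :=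
  (lift_t _ _ _ _ _ j i).trans Matrix.one_apply

theorem counit_gInv : Coalgebra.counit (R := k) (gInv k n q) = 1 :=
  lift_gInv _ _ _ _ _

variable (k n q)

/-- The generators of `A(R_q)` have degree `1`, and `g⁻¹` has degree `-n`. -/
def genDegree : Option (Fin n × Fin n) → ℤ
  | none => -n
  | some _ => 1

/-- The homogeneous component of degree `m`, spanned by the monomials of degree `m`. -/
noncomputable def grading (m : ℤ) : Submodule k (QuantumGL k n q) :=
  Submodule.span k {x | ∃ l : List (Option (Fin n × Fin n)),
    (l.map (genDegree n)).sum = m ∧ (l.map (gen k n q)).prod = x}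

instance : SetLike.GradedMonoid (grading k n q) where
  one_mem := Submodule.subset_span ⟨[], by simp⟩
  mul_mem := by
    intro i j x y hx hy
    have h := Submodule.mul_mem_mul hx hy
    rw [grading, grading, Submodule.span_mul_span] at h
    refine Submodule.span_mono ?_ h
    rintro _ ⟨_, ⟨l, rfl, rfl⟩, _, ⟨l', rfl, rfl⟩, rfl⟩
    exact ⟨l ++ l', by simp, by simp⟩

variable {k n q}

theorem gen_mem (x : Option (Fin n × Fin n)) : gen k n q x ∈ grading k n q (genDegree n x) :=
  Submodule.subset_span ⟨[x], by simp, by simp⟩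

open DirectSum

/-- Homogeneity in the external direct sum of the components. -/
def IsHom (m : ℤ) (y : ⨁ m, grading k n q m) : Prop := ∃ x, y = DirectSum.of _ m x

theorem IsHom.eq {m : ℤ} {y z : ⨁ m, grading k n q m} (hy : IsHom m y) (hz : IsHom m z)
    (h : DirectSum.coeAlgHom (grading k n q) y = DirectSum.coeAlgHom (grading k n q) z) :
    y = z := by
  obtain ⟨a, rfl⟩ := hy
  obtain ⟨b, rfl⟩ := hz
  rw [DirectSum.coeAlgHom_of, DirectSum.coeAlgHom_of] at h
  rw [Subtype.ext h]

theorem IsHom.mul {i j : ℤ} {y z : ⨁ m, grading k n q m} (hy : IsHom i y) (hz : IsHom j z) :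
    IsHom (i + j) (y * z) := by
  obtain ⟨a, rfl⟩ := hy
  obtain ⟨b, rfl⟩ := hz
  exact ⟨_, DirectSum.of_mul_of _ _⟩

theorem IsHom.smul {i : ℤ} {y : ⨁ m, grading k n q m} (c : k) (hy : IsHom i y) :
    IsHom i (c • y) := by
  obtain ⟨a, rfl⟩ := hy
  exact ⟨c • a, ((DirectSum.lof k ℤ (fun m => grading k n q m) i).map_smul c a).symm⟩

theorem IsHom.sum {ι : Type*} {i : ℤ} (s : Finset ι) {y : ι → ⨁ m, grading k n q m}
    (hy : ∀ a, IsHom i (y a)) : IsHom i (∑ a ∈ s, y a) := by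
  choose x hx using hy
  exact ⟨∑ a ∈ s, x a, by simp [hx]⟩

theorem IsHom.list_prod {ι : Type*} (l : List ι) (δ : ι → ℤ) (y : ι → ⨁ m, grading k n q m)
    (hy : ∀ a, IsHom (δ a) (y a)) : IsHom (l.map δ).sum (l.map y).prod := by
  induction l with
  | nil => exact ⟨(1 : grading k n q 0), rfl⟩
  | cons a l ih => simpa using (hy a).mul ih

noncomputable def homGen (x : Option (Fin n × Fin n)) : ⨁ m, grading k n q m :=
  DirectSum.of (fun m => grading k n q m) (genDegree n x) ⟨gen k n q x, gen_mem x⟩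

theorem isHom_homGen (x : Option (Fin n × Fin n)) :
    IsHom (genDegree n x) (homGen (k := k) (q := q) x) := ⟨_, rfl⟩

theorem coe_homGen (x : Option (Fin n × Fin n)) :
    DirectSum.coeAlgHom (grading k n q) (homGen x) = gen k n q x := DirectSum.coeAlgHom_of _ _ _

noncomputable def homT : Matrix (Fin n) (Fin n) (⨁ m, grading k n q m) :=
  Matrix.of fun j i => homGen (some (j, i))

theorem isHom_qdet : IsHom (n : ℤ) (qdet q (homT (k := k) (n := n) (q := q))) := by
  refine IsHom.sum _ fun s => IsHom.smul _ ?_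
  rw [List.ofFn_eq_map]
  simpa [genDegree] using IsHom.list_prod (List.finRange n) (fun _ => 1)
    (fun i => homT (k := k) (q := q) (s i) i) (fun i => isHom_homGen (some (s i, i)))

theorem coe_qdet : DirectSum.coeAlgHom (grading k n q) (qdet q homT) = qdet q (t k n q) := by
  rw [map_qdet]
  congr 1
  ext j i
  exact coe_homGen _

theorem isHom_one : IsHom 0 (1 : ⨁ m, grading k n q m) :=
  ⟨(1 : grading k n q 0), rfl⟩

theorem coe_homT :
    (homT (k := k) (n := n) (q := q)).map (DirectSum.coeAlgHom (grading k n q)) = t k n q := by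
  ext j i
  exact coe_homGen _

theorem isHom_homT (j i : Fin n) : IsHom 1 (homT (k := k) (q := q) j i) :=
  isHom_homGen (some (j, i))

theorem isFRT_homT : IsFRT (rqMatrix n q) (homT (k := k) (n := n) (q := q)) := by
  intro u v a b
  refine IsHom.eq (m := 1 + 1)
    (.sum _ fun i => .sum _ fun j => .smul _ ((isHom_homT j u).mul (isHom_homT i v)))
    (.sum _ fun i => .sum _ fun j => .smul _ ((isHom_homT a i).mul (isHom_homT b j))) ?_
  rw [map_frt_left, map_frt_right, coe_homT]
  exact isFRT_t u v a b

theorem IsHom.cast {i j : ℤ} {y : ⨁ m, grading k n q m} (hy : IsHom i y) (h : i = j) :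
    IsHom j y := h ▸ hy

theorem qdet_homT_mul : qdet q (homT (k := k) (n := n) (q := q)) * homGen none = 1 := by
  have h := (isHom_qdet (k := k) (n := n) (q := q)).mul (isHom_homGen none)
  refine IsHom.eq (m := 0) (h.cast ?_) isHom_one ?_
  · exact add_neg_cancel (n : ℤ)
  · rw [map_mul, coe_qdet, coe_homGen, map_one]; exact qdet_mul_gInv

theorem mul_qdet_homT : homGen none * qdet q (homT (k := k) (n := n) (q := q)) = 1 := by
  refine IsHom.eq (m := 0) (((isHom_homGen none).mul isHom_qdet).cast ?_) isHom_one ?_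
  · exact neg_add_cancel (n : ℤ)
  · rw [map_mul, coe_qdet, coe_homGen, map_one]; exact gInv_mul_qdet

noncomputable def decomposeHom : QuantumGL k n q →ₐ[k] ⨁ m, grading k n q m :=
  lift homT (homGen none) isFRT_homT qdet_homT_mul mul_qdet_homT

theorem decomposeHom_gen (x : Option (Fin n × Fin n)) :
    decomposeHom (gen k n q x) = homGen x := by
  rw [decomposeHom, lift_gen]
  cases x <;> rfl

theorem coe_decomposeHom :
    (DirectSum.coeAlgHom (grading k n q)).comp decomposeHom = AlgHom.id k _ :=
  hom_ext' fun x => by rw [AlgHom.comp_apply, decomposeHom_gen, coe_homGen]; rfl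

noncomputable instance : GradedAlgebra (grading k n q) :=
  GradedAlgebra.ofAlgHom _ decomposeHom coe_decomposeHom (by
    have key : ∀ (i : ℤ) (x : QuantumGL k n q), x ∈ grading k n q i →
        IsHom i (decomposeHom x) := by
      intro i x hx
      induction hx using Submodule.span_induction with
      | mem x hx =>
        obtain ⟨l, rfl, rfl⟩ := hx
        rw [map_list_prod, List.map_map]
        exact IsHom.list_prod l _ _ fun a => by
          rw [Function.comp_apply, decomposeHom_gen]; exact isHom_homGen a
      | zero => exact ⟨0, by simp⟩
      | add x y _ _ hx hy =>
        obtain ⟨a, ha⟩ := hx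
        obtain ⟨b, hb⟩ := hy
        exact ⟨a + b, by rw [map_add, map_add, ha, hb]⟩
      | smul c x _ hx => rw [map_smul]; exact hx.smul c
    rintro i ⟨x, hx⟩
    refine (key i x hx).eq ⟨_, rfl⟩ ?_
    rw [DirectSum.coeAlgHom_of]
    exact AlgHom.congr_fun coe_decomposeHom x)

end QuantumGL
end QGL

section Twist
variable {k : Type*} [Field k] {B : Type*} [Ring B] [Bialgebra k B]

/-- Twisting pairs of a bialgebra: algebra automorphisms with `Δ φ₁ = (id ⊗ φ₁) Δ`,
`Δ φ₂ = (φ₂ ⊗ id) Δ` and `ε φ₁ φ₂ = ε`. -/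
structure IsTwistingPair (φ₁ φ₂ : B ≃ₐ[k] B) : Prop where
  comul_left : Coalgebra.comul ∘ₗ φ₁.toLinearMap =
    φ₁.toLinearMap.lTensor B ∘ₗ (Coalgebra.comul : B →ₗ[k] B ⊗[k] B)
  comul_right : Coalgebra.comul ∘ₗ φ₂.toLinearMap =
    φ₂.toLinearMap.rTensor B ∘ₗ (Coalgebra.comul : B →ₗ[k] B ⊗[k] B)
  counit : Coalgebra.counit ∘ₗ φ₁.toLinearMap ∘ₗ φ₂.toLinearMap =
    (Coalgebra.counit : B →ₗ[k] k)

/-- The convolution inverse of a bilinear form on `B` (meaningful when one exists). -/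
noncomputable def convInv (σ : B ⊗[k] B →ₗ[k] k) : B ⊗[k] B →ₗ[k] k :=
  (Ring.inverse (WithConv.toConv σ)).ofConv

/-- Two-cocycles: convolution invertible forms with
`∑ σ(x₁, y₁) σ(x₂ y₂, z) = ∑ σ(y₁, z₁) σ(x, y₂ z₂)` and `σ(x, 1) = σ(1, x) = ε(x)`. The product of
`WithConv` is the convolution product, here over the coalgebra `B ⊗ B`. -/
structure IsTwoCocycle (σ : B ⊗[k] B →ₗ[k] k) : Prop where
  isUnit : IsUnit (WithConv.toConv σ)
  cocycle (x y z : B) :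
    (WithConv.toConv σ *
        WithConv.toConv ((TensorProduct.curry σ).flip z ∘ₗ LinearMap.mul' k B)) (x ⊗ₜ[k] y) =
      (WithConv.toConv σ *
        WithConv.toConv (TensorProduct.curry σ x ∘ₗ LinearMap.mul' k B)) (y ⊗ₜ[k] z)
  one_right (x : B) : σ (x ⊗ₜ[k] 1) = Coalgebra.counit x
  one_left (x : B) : σ (1 ⊗ₜ[k] x) = Coalgebra.counit x

/-- The form with `σ(x, y) = ε(x) ε(φ^|x| (y))` for homogeneous `x` (see `twistForm_apply`). -/
noncomputable def twistForm (𝒜 : ℤ → Submodule k B) [GradedAlgebra 𝒜] (φ : B ≃ₐ[k] B) :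
    B ⊗[k] B →ₗ[k] k :=
  TensorProduct.lift
    (DirectSum.toModule k ℤ (B →ₗ[k] k)
        (fun m => (Coalgebra.counit ∘ₗ (𝒜 m).subtype).smulRight
          (Coalgebra.counit ∘ₗ (φ ^ m).toLinearMap)) ∘ₗ
      (DirectSum.decomposeLinearEquiv 𝒜).toLinearMap)

theorem twistForm_apply (𝒜 : ℤ → Submodule k B) [GradedAlgebra 𝒜] (φ : B ≃ₐ[k] B) {m : ℤ}
    {x : B} (hx : x ∈ 𝒜 m) (y : B) :
    twistForm 𝒜 φ (x ⊗ₜ[k] y) = Coalgebra.counit (R := k) x *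
      Coalgebra.counit (R := k) ((φ ^ m) y) := by
  simp only [twistForm, TensorProduct.lift.tmul, LinearMap.comp_apply, LinearEquiv.coe_coe,
    DirectSum.decomposeLinearEquiv_apply, DirectSum.decompose_of_mem 𝒜 hx]
  erw [DirectSum.toModule_lof]
  rfl

/-- The coefficients of the twisted operator, with upper indices `c` and lower indices `d`:
`∑ σ(t^{c₁}_u, t^{c₂}_v) R^{uv}_{pr} σ⁻¹(t^r_{d₂}, t^p_{d₁})`. -/
noncomputable def twistMatrix {n : ℕ} (T : Matrix (Fin n) (Fin n) B)
    (R : Matrix (Fin n × Fin n) (Fin n × Fin n) k) (σ : B ⊗[k] B →ₗ[k] k) :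
    Matrix (Fin n × Fin n) (Fin n × Fin n) k :=
  Matrix.of fun c d => ∑ u, ∑ v, ∑ p, ∑ r,
    σ (T c.1 u ⊗ₜ[k] T c.2 v) * R (u, v) (p, r) * convInv σ (T r d.2 ⊗ₜ[k] T p d.1)

end Twist

section Operators
variable {k : Type*} [Field k] {V : Type*} [AddCommGroup V] [Module k V] {n : ℕ}

/-- The classical Yang-Baxter operator `R_q` with respect to the basis `v`. -/
noncomputable def ybOperator (v : Module.Basis (Fin n) k V) (q : kˣ) :
    Module.End k (V ⊗[k] V) :=
  (v.tensorProduct v).constr k fun p =>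
    if p.1 = p.2 then (q : k) • (v p.1 ⊗ₜ[k] v p.1)
    else if p.1 < p.2 then v p.1 ⊗ₜ[k] v p.2
    else v p.1 ⊗ₜ[k] v p.2 + ((q : k) - ((q⁻¹ : kˣ) : k)) • (v p.2 ⊗ₜ[k] v p.1)

/-- `coeffs v R (a, b) (i, j)` is the coefficient of `v a ⊗ v b` in `R (v i ⊗ v j)`. -/
noncomputable def coeffs (v : Module.Basis (Fin n) k V) (R : Module.End k (V ⊗[k] V)) :
    Matrix (Fin n × Fin n) (Fin n × Fin n) k :=
  LinearMap.toMatrix (v.tensorProduct v) (v.tensorProduct v) R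

theorem coeffs_ybOperator (v : Module.Basis (Fin n) k V) (q : kˣ) :
    coeffs v (ybOperator v q) = rqMatrix n q := by
  ext ⟨a, b⟩ ⟨i, j⟩
  have h : ∀ x y : Fin n, (v.tensorProduct v).repr (v x ⊗ₜ[k] v y) (a, b) =
      if (a, b) = (x, y) then 1 else 0 := by
    intro x y
    rw [← Module.Basis.tensorProduct_apply, Module.Basis.repr_self, Finsupp.single_apply]
    simp only [eq_comm]
  rw [coeffs, LinearMap.toMatrix_apply, ybOperator, Module.Basis.constr_basis]
  simp only [rqMatrix, Prod.swap_prod_mk]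
  rcases lt_trichotomy i j with h1 | h1 | h1
  · simp [h1.ne, h1, h1.not_gt, h]
  · subst h1; simp [h]
  · simp [h1.ne', h1, h1.not_gt, h]

/-- The quantum Yang-Baxter equation `R₁₂ R₁₃ R₂₃ = R₂₃ R₁₃ R₁₂` on `V ⊗ (V ⊗ V)`. -/
def IsQYBE (R : Module.End k (V ⊗[k] V)) : Prop :=
  let R₂₃ : Module.End k (V ⊗[k] (V ⊗[k] V)) := R.lTensor V
  let R₁₂ : Module.End k (V ⊗[k] (V ⊗[k] V)) :=
    (TensorProduct.assoc k V V V).toLinearMap ∘ₗ R.rTensor V ∘ₗ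
      (TensorProduct.assoc k V V V).symm.toLinearMap
  let flip₂₃ : Module.End k (V ⊗[k] (V ⊗[k] V)) :=
    (TensorProduct.comm k V V).toLinearMap.lTensor V
  let R₁₃ : Module.End k (V ⊗[k] (V ⊗[k] V)) := flip₂₃ ∘ₗ R₁₂ ∘ₗ flip₂₃
  R₁₂ ∘ₗ R₁₃ ∘ₗ R₂₃ = R₂₃ ∘ₗ R₁₃ ∘ₗ R₁₂

/-- The operator on `V ⊗ V` with coefficients `twistMatrix`, where `T` is the matrix of
coefficients of the coaction on `V`. -/
noncomputable def twistOperator {B : Type*} [Ring B] [Bialgebra k B]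
    (v : Module.Basis (Fin n) k V) (T : Matrix (Fin n) (Fin n) B) (R : Module.End k (V ⊗[k] V))
    (σ : B ⊗[k] B →ₗ[k] k) : Module.End k (V ⊗[k] V) :=
  Matrix.toLin (v.tensorProduct v) (v.tensorProduct v) (twistMatrix T (coeffs v R) σ)

end Operators

end TwistR

/-! An automorphism `φ` with `Δφ = (φ ⊗ id)Δ` is recovered from the character `εφ`, since `φ(x) = ∑
εφ(x₁) x₂`. Composition of such automorphisms therefore corresponds, in reversed order, to
convolution of characters (`sum_counit_mul_counit`). As `Δ` respects the grading, the form `σ(x, y)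
= ε(x) ε(φ₂^|x|(y))` can be handled degree by degree: replacing `φ₂` by `φ₂⁻¹` gives the convolution
inverse, and for `x`, `y` of degrees `m`, `p` both sides of the cocycle identity equal `ε(x) ε(φ₂^m
y) ε(φ₂^(m+p) z)`.

Take `α` and `β` to be the matrices of values of `εφ₁` and `εφ₂` at the generators. They are
mutually inverse because `εφ₁φ₂ = ε`. The generators have degree 1, so the twist collapses to `R^σ =
(1 ⊗ β) R_q (α ⊗ 1)` (`twistMatrix_twistForm`). Since `εφ₁` is an algebra map, `α` is a scalar
solution of the relations of `A(R_q)`, which says exactly that `α ⊗ α` commutes with `R_q`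
(`IsFRT.mul_kronecker`). This commutation makes the Yang–Baxter equation pass from `R_q` to `R^σ`
(`yangBaxter_twist`, `IsQYBE.twist`).

The explicit formulas come from the scalar relations. If `q ≠ 1`, two entries of `α` in the same row
or the same column have product zero, so `α` is a generalized permutation matrix
(`IsFRT.exists_perm`). If moreover `q ≠ -1`, the permutation can have no inversion, so `α` is
diagonal (`IsFRT.apply_eq_zero`). If `q = ±1`, then `R_q` itself is diagonal in the tensor basis and
the sum for `R^σ` has a single term. -/

namespace TwistR

/-! ### Automorphisms as characters, and the two-cocycle. -/

section Coalgebra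
variable {k : Type*} [Field k] {B : Type*} [Ring B] [Bialgebra k B]

open Coalgebra

/-- The algebra automorphisms `φ` with `Δ φ = (φ ⊗ id) Δ`. -/
def comulAut (k : Type*) [Field k] (B : Type*) [Ring B] [Bialgebra k B] :
    Subgroup (B ≃ₐ[k] B) where
  carrier := {φ | ∀ x, comul (R := k) (φ x) = φ.toLinearMap.rTensor B (comul (R := k) x)}
  one_mem' x := by
    have : (1 : B ≃ₐ[k] B).toLinearMap = LinearMap.id := rfl
    rw [this, LinearMap.rTensor_id]
    rfl
  mul_mem' {φ ψ} hφ hψ x := by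
    have : (φ * ψ).toLinearMap = φ.toLinearMap ∘ₗ ψ.toLinearMap := rfl
    rw [this, LinearMap.rTensor_comp_apply, ← hψ, ← hφ]
    rfl
  inv_mem' {φ} hφ x := by
    have h : (φ⁻¹).toLinearMap ∘ₗ φ.toLinearMap = LinearMap.id :=
      LinearMap.ext φ.symm_apply_apply
    have hx : φ (φ⁻¹ x) = x := φ.apply_symm_apply x
    conv_rhs => rw [← hx, hφ, ← LinearMap.rTensor_comp_apply, h, LinearMap.rTensor_id]
    rfl

theorem mem_comulAut {φ : B ≃ₐ[k] B} : φ ∈ comulAut k B ↔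
    comul ∘ₗ φ.toLinearMap = φ.toLinearMap.rTensor B ∘ₗ (comul : B →ₗ[k] B ⊗[k] B) :=
  ⟨fun h => LinearMap.ext h, fun h => LinearMap.congr_fun h⟩

/-- Applying `φ` to the left legs of `Δ x` gives a representation of `Δ (φ x)`, to which the counit
axiom applies. Thus `φ` is convolution by the character `εφ`. -/
theorem sum_counit_smul_of_mem {φ : B ≃ₐ[k] B} (hφ : φ ∈ comulAut k B) {ι : Type*} {x : B}
    (r : Repr k x ι) : ∑ i ∈ r.index, counit (R := k) (φ (r.left i)) • r.right i = φ x :=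
  sum_counit_smul (⟨r.index, fun i => φ (r.left i), r.right, by
    rw [hφ x, ← r.eq, map_sum]; rfl⟩ : Repr k (φ x) ι)

/-- The convolution of `εφ` and `εψ` is `εψφ`: the order of composition is reversed, and only `φ`
has to be compatible with `Δ`. -/
theorem sum_counit_mul_counit {φ : B ≃ₐ[k] B} (hφ : φ ∈ comulAut k B) (ψ : B ≃ₐ[k] B)
    {ι : Type*} {x : B} (r : Repr k x ι) :
    ∑ i ∈ r.index, counit (R := k) (φ (r.left i)) * counit (R := k) (ψ (r.right i)) =
      counit (R := k) (ψ (φ x)) := by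
  rw [← sum_counit_smul_of_mem hφ r]
  simp

theorem sum_counit_zpow {φ : B ≃ₐ[k] B} (hφ : φ ∈ comulAut k B) (m p : ℤ)
    {ι : Type*} {x : B} (r : Repr k x ι) :
    ∑ i ∈ r.index, counit (R := k) ((φ ^ m) (r.left i)) * counit (R := k) ((φ ^ p) (r.right i)) =
      counit (R := k) ((φ ^ (m + p)) x) := by
  rw [sum_counit_mul_counit (zpow_mem hφ m), add_comm m, zpow_add]
  rfl

theorem sum_counit_zpow_left {φ : B ≃ₐ[k] B} (hφ : φ ∈ comulAut k B) (m : ℤ)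
    {ι : Type*} {x : B} (r : Repr k x ι) :
    ∑ i ∈ r.index, counit (R := k) ((φ ^ m) (r.left i)) * counit (R := k) (r.right i) =
      counit (R := k) ((φ ^ m) x) := by
  simpa using sum_counit_zpow hφ m 0 r

theorem sum_counit_counit {ι : Type*} {x : B} (r : Repr k x ι) :
    ∑ i ∈ r.index, counit (R := k) (r.left i) * counit (R := k) (r.right i) =
      counit (R := k) x := by
  simpa using sum_counit_zpow (one_mem (comulAut k B)) 0 0 r

theorem convMul_tmul (f g : B ⊗[k] B →ₗ[k] k) {ι κ : Type*} {x y : B} (r : Repr k x ι)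
    (s : Repr k y κ) :
    (WithConv.toConv f * WithConv.toConv g) (x ⊗ₜ[k] y) =
      ∑ i ∈ r.index, ∑ j ∈ s.index,
        f (r.left i ⊗ₜ s.left j) * g (r.right i ⊗ₜ s.right j) := by
  rw [LinearMap.convMul_apply, TensorProduct.comul_tmul, ← r.eq, ← s.eq]
  simp only [TensorProduct.sum_tmul, TensorProduct.tmul_sum, map_sum]
  exact Finset.sum_comm

/-- A coalgebra grading: `Δ` maps each component `𝒜 m` into `𝒜 m ⊗ 𝒜 m`. -/
def IsCoalgebraGrading (𝒜 : ℤ → Submodule k B) : Prop :=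
  ∀ m, ∀ x ∈ 𝒜 m, comul (R := k) x ∈
    LinearMap.range (TensorProduct.map (𝒜 m).subtype (𝒜 m).subtype)

/-- Makes `twistForm_apply` available on every leg of `Δ x`, with the same exponent `m` throughout.
-/
theorem IsCoalgebraGrading.exists_repr {𝒜 : ℤ → Submodule k B} (h : IsCoalgebraGrading 𝒜) {m : ℤ}
    {x : B} (hx : x ∈ 𝒜 m) :
    ∃ r : Repr k x (𝒜 m × 𝒜 m), (∀ i, r.left i ∈ 𝒜 m) ∧ ∀ i, r.right i ∈ 𝒜 m := by
  obtain ⟨z, hz⟩ := h m x hx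
  obtain ⟨S, rfl⟩ := TensorProduct.exists_finset z
  refine ⟨⟨S, fun i => i.1, fun i => i.2, ?_⟩, fun i => i.1.2, fun i => i.2.2⟩
  rw [← hz, map_sum]
  rfl

variable {𝒜 : ℤ → Submodule k B} [GradedAlgebra 𝒜]

/-- All left and right legs of `x` have degree `m`, so the sum splits into a factor in `x`, which
collapses by the counit axiom, and a convolution of two characters in `y`. -/
theorem twistForm_convMul_apply (h𝒜 : IsCoalgebraGrading 𝒜) (φ ψ : B ≃ₐ[k] B)
    (hφ : φ ∈ comulAut k B) {m : ℤ} {x : B} (hx : x ∈ 𝒜 m) (y : B) :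
    (WithConv.toConv (twistForm 𝒜 φ) * WithConv.toConv (twistForm 𝒜 ψ)) (x ⊗ₜ[k] y) =
      counit (R := k) x * counit (R := k) ((ψ ^ m) ((φ ^ m) y)) := by
  obtain ⟨r, hl, hr⟩ := h𝒜.exists_repr hx
  rw [convMul_tmul _ _ r (Repr.arbitrary k y)]
  simp only [twistForm_apply 𝒜 _ (hl _), twistForm_apply 𝒜 _ (hr _)]
  rw [← sum_counit_mul_counit (zpow_mem hφ m) (ψ ^ m) (Repr.arbitrary k y),
    ← sum_counit_counit r, Finset.sum_mul_sum]
  refine Finset.sum_congr rfl fun i _ => Finset.sum_congr rfl fun j _ => ?_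
  ring

theorem twistForm_mul_inv (h𝒜 : IsCoalgebraGrading 𝒜) (φ : B ≃ₐ[k] B)
    (hφ : φ ∈ comulAut k B) :
    WithConv.toConv (twistForm 𝒜 φ) * WithConv.toConv (twistForm 𝒜 φ⁻¹) = 1 := by
  refine WithConv.ofConv_injective (TensorProduct.ext' fun x y => ?_)
  induction x using DirectSum.Decomposition.inductionOn 𝒜 with
  | zero => rw [TensorProduct.zero_tmul, map_zero, map_zero]
  | add x x' hx hx' => rw [TensorProduct.add_tmul, map_add, map_add, hx, hx']
  | @homogeneous m x =>
    refine (twistForm_convMul_apply h𝒜 φ φ⁻¹ hφ x.2 y).trans ?_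
    have : ((φ⁻¹) ^ m) ((φ ^ m) y) = y := by
      rw [← AlgEquiv.mul_apply, inv_zpow, inv_mul_cancel, AlgEquiv.one_apply]
    rw [this, mul_comm]
    rfl

theorem twistForm_inv_mul (h𝒜 : IsCoalgebraGrading 𝒜) (φ : B ≃ₐ[k] B)
    (hφ : φ ∈ comulAut k B) :
    WithConv.toConv (twistForm 𝒜 φ⁻¹) * WithConv.toConv (twistForm 𝒜 φ) = 1 := by
  simpa using twistForm_mul_inv h𝒜 φ⁻¹ (inv_mem hφ)

theorem convInv_twistForm (h𝒜 : IsCoalgebraGrading 𝒜) (φ : B ≃ₐ[k] B)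
    (hφ : φ ∈ comulAut k B) : convInv (twistForm 𝒜 φ) = twistForm 𝒜 φ⁻¹ :=
  congrArg WithConv.ofConv (Ring.inverse_unit
    ⟨_, _, twistForm_mul_inv h𝒜 φ hφ, twistForm_inv_mul h𝒜 φ hφ⟩)

theorem isTwoCocycle_twistForm (h𝒜 : IsCoalgebraGrading 𝒜) (φ : B ≃ₐ[k] B)
    (hφ : φ ∈ comulAut k B) : IsTwoCocycle (twistForm 𝒜 φ) where
  isUnit := ⟨⟨_, _, twistForm_mul_inv h𝒜 φ hφ, twistForm_inv_mul h𝒜 φ hφ⟩, rfl⟩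
  cocycle x y z := by
    -- The left side is expanded and folded back. The right side stays expanded, since folded it
    -- hides its linearity in `x`, which the induction on `x` needs.
    rw [convMul_tmul _ _ (Repr.arbitrary k x) (Repr.arbitrary k y),
      convMul_tmul _ _ (Repr.arbitrary k y) (Repr.arbitrary k z),
      ← convMul_tmul _ _ (Repr.arbitrary k x) (Repr.arbitrary k y)]
    induction x using DirectSum.Decomposition.inductionOn 𝒜 with
    | zero => simp [TensorProduct.zero_tmul]
    | add x x' hx hx' =>
      rw [TensorProduct.add_tmul, map_add, hx, hx']
      simp [mul_add, Finset.sum_add_distrib]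
    | @homogeneous m x =>
    -- With `x` homogeneous, the right side is folded back into a linear function of `y ⊗ z` for the
    -- induction on `y`.
    rw [← convMul_tmul _ _ (Repr.arbitrary k y) (Repr.arbitrary k z)]
    induction y using DirectSum.Decomposition.inductionOn 𝒜 with
    | zero => simp [TensorProduct.zero_tmul]
    | add y y' hy hy' =>
      rw [TensorProduct.add_tmul, map_add, TensorProduct.tmul_add, map_add, hy, hy']
    | @homogeneous p y =>
    obtain ⟨r, hr, hr'⟩ := h𝒜.exists_repr x.2
    obtain ⟨s, hs, hs'⟩ := h𝒜.exists_repr y.2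
    rw [convMul_tmul _ _ r s, convMul_tmul _ _ s (Repr.arbitrary k z)]
    simp only [LinearMap.comp_apply, LinearMap.mul'_apply, LinearMap.flip_apply,
      TensorProduct.curry_apply, twistForm_apply 𝒜 _ (hr _), twistForm_apply 𝒜 _ (hs _),
      twistForm_apply 𝒜 _ x.2,
      twistForm_apply 𝒜 _ (SetLike.mul_mem_graded (hr' _) (hs' _)), map_mul,
      Bialgebra.counit_mul]
    -- The common value of both sides. On the left the exponent `m + p` is the degree of `x₂ y₂`; on
    -- the right it comes from convolving `εφ^p` and `εφ^m` along `Δ z`, after `φ^m (y₂ z₂)` has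
    -- been split multiplicatively.
    trans counit (R := k) (x : B) * counit (R := k) ((φ ^ m) (y : B)) *
      counit (R := k) ((φ ^ (m + p)) z)
    · rw [← sum_counit_counit r, ← sum_counit_zpow_left hφ m s, Finset.sum_mul_sum,
        Finset.sum_mul]
      refine Finset.sum_congr rfl fun i _ => ?_
      rw [Finset.sum_mul]
      refine Finset.sum_congr rfl fun j _ => ?_
      ring
    · rw [add_comm m, ← sum_counit_zpow hφ p m (Repr.arbitrary k z)]
      have h : counit (R := k) ((φ ^ m) (y : B)) =
          ∑ j ∈ s.index, counit (R := k) (s.left j) * counit (R := k) ((φ ^ m) (s.right j)) := by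
        simpa using (sum_counit_zpow hφ 0 m s).symm
      rw [h, mul_assoc, Finset.sum_mul_sum, Finset.mul_sum]
      refine Finset.sum_congr rfl fun i _ => ?_
      rw [Finset.mul_sum]
      refine Finset.sum_congr rfl fun j _ => ?_
      ring
  one_right x := by
    induction x using DirectSum.Decomposition.inductionOn 𝒜 with
    | zero => simp
    | add x x' hx hx' => rw [TensorProduct.add_tmul, map_add, map_add, hx, hx']
    | homogeneous x => rw [twistForm_apply 𝒜 _ x.2]; simp
  one_left x := by
    -- The unit has degree 0, so the power of `φ` is the identity.
    rw [twistForm_apply 𝒜 _ (SetLike.GradedOne.one_mem (A := 𝒜))]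
    simp

end Coalgebra

/-! ### The Yang–Baxter equation for `R_q` and for its twists. -/

section YangBaxter
variable {k : Type*} [Field k] {V : Type*} [AddCommGroup V] [Module k V] {n : ℕ}

open TensorProduct

theorem end_ext_threefold {f g : Module.End k (V ⊗[k] (V ⊗[k] V))}
    (h : ∀ x y z, f (x ⊗ₜ (y ⊗ₜ z)) = g (x ⊗ₜ (y ⊗ₜ z))) : f = g :=
  TensorProduct.ext (LinearMap.ext fun x => TensorProduct.ext' fun y z => h x y z)

/-- The operator on the first two factors of `V ⊗ (V ⊗ V)` induced by an operator on `V ⊗ V`. -/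
noncomputable def firstTwo : Module.End k (V ⊗[k] V) →* Module.End k (V ⊗[k] (V ⊗[k] V)) where
  toFun R := (TensorProduct.assoc k V V V).toLinearMap ∘ₗ R.rTensor V ∘ₗ
    (TensorProduct.assoc k V V V).symm.toLinearMap
  map_one' := by
    refine end_ext_threefold fun x y z => ?_
    simp
  map_mul' R S := by
    refine LinearMap.ext fun x => ?_
    simp [Module.End.mul_eq_comp, LinearMap.rTensor_comp_apply]

/-- The operator on the last two factors of `V ⊗ (V ⊗ V)` induced by an operator on `V ⊗ V`. -/
noncomputable def lastTwo : Module.End k (V ⊗[k] V) →* Module.End k (V ⊗[k] (V ⊗[k] V)) where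
  toFun R := R.lTensor V
  map_one' := LinearMap.lTensor_id _ _
  map_mul' R S := LinearMap.lTensor_mul _ R S

/-- The exchange of the last two factors of `V ⊗ (V ⊗ V)`. -/
noncomputable def swapLast : Module.End k (V ⊗[k] (V ⊗[k] V)) :=
  (TensorProduct.comm k V V).toLinearMap.lTensor V

theorem swapLast_mul_self : (swapLast : Module.End k (V ⊗[k] (V ⊗[k] V))) * swapLast = 1 := by
  refine end_ext_threefold fun x y z => ?_
  simp [swapLast]

/-- The operator on the outer factors of `V ⊗ (V ⊗ V)` induced by an operator on `V ⊗ V`. -/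
noncomputable def outerTwo : Module.End k (V ⊗[k] V) →* Module.End k (V ⊗[k] (V ⊗[k] V)) where
  toFun R := swapLast * firstTwo R * swapLast
  map_one' := by rw [map_one, mul_one, swapLast_mul_self]
  map_mul' R S := by
    have : ∀ a b : Module.End k (V ⊗[k] (V ⊗[k] V)), swapLast * a * swapLast *
        (swapLast * b * swapLast) = swapLast * a * (swapLast * swapLast) * b * swapLast := by
      intro a b
      simp only [mul_assoc]
    rw [this, swapLast_mul_self, map_mul, mul_one]
    simp only [mul_assoc]

theorem isQYBE_iff (R : Module.End k (V ⊗[k] V)) : IsQYBE R ↔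
    firstTwo R * outerTwo R * lastTwo R = lastTwo R * outerTwo R * firstTwo R := Iff.rfl

theorem firstTwo_map (A C : Module.End k V) :
    firstTwo (map A C) = map A (map C LinearMap.id) := by
  refine end_ext_threefold fun x y z => ?_
  simp [firstTwo]

theorem swapLast_map (A C D : Module.End k V) :
    swapLast * map A (map C D) * swapLast = map A (map D C) := by
  refine end_ext_threefold fun x y z => ?_
  simp [swapLast]

theorem outerTwo_map (A C : Module.End k V) :
    outerTwo (map A C) = map A (map LinearMap.id C) := by
  rw [← swapLast_map, ← firstTwo_map]
  rfl

theorem lastTwo_map (A C : Module.End k V) :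
    lastTwo (map A C) = map LinearMap.id (map A C) := rfl

/-- An operator on one tensor factor commutes with an operator on the other two; likewise in the
next two lemmas. -/
theorem firstTwo_comm (R : Module.End k (V ⊗[k] V)) (C : Module.End k V) :
    map LinearMap.id (map LinearMap.id C) * firstTwo R =
      firstTwo R * map LinearMap.id (map LinearMap.id C) := by
  refine end_ext_threefold fun x y z => ?_
  have : ∀ w : V ⊗[k] V, map LinearMap.id (map LinearMap.id C)
      (TensorProduct.assoc k V V V (w ⊗ₜ z)) = TensorProduct.assoc k V V V (w ⊗ₜ C z) := by
    intro w
    induction w with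
    | zero => simp
    | add w w' h h' => simp [add_tmul, h, h']
    | tmul a b => simp
  simpa [firstTwo] using this _

theorem outerTwo_comm (R : Module.End k (V ⊗[k] V)) (C : Module.End k V) :
    map LinearMap.id (map C LinearMap.id) * outerTwo R =
      outerTwo R * map LinearMap.id (map C LinearMap.id) := by
  rw [← swapLast_map]
  have h : ∀ a b : Module.End k (V ⊗[k] (V ⊗[k] V)), swapLast * a * swapLast *
      (swapLast * b * swapLast) = swapLast * (a * b) * swapLast := by
    intro a b
    calc _ = swapLast * a * (swapLast * swapLast) * b * swapLast := by simp only [mul_assoc]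
      _ = _ := by rw [swapLast_mul_self]; simp only [mul_assoc, one_mul]
  exact (h _ _).trans (.trans (by rw [firstTwo_comm]) (h _ _).symm)

theorem lastTwo_comm (R : Module.End k (V ⊗[k] V)) (A : Module.End k V) :
    map A (map LinearMap.id LinearMap.id) * lastTwo R =
      lastTwo R * map A (map LinearMap.id LinearMap.id) := by
  refine end_ext_threefold fun x y z => ?_
  simp [lastTwo]

/-- The computation in an abstract monoid: `r₁`, `r₂`, `r₃` stand for `R₁₂`, `R₁₃`, `R₂₃`, while
`aᵢ` and `bᵢ` stand for `A` and `A⁻¹` acting on the `i`-th factor. The twisting factors are moved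
outwards until `r₁ r₂ r₃` stands alone, the equation for `R` is applied, and the moves are undone.
-/
theorem yangBaxter_twist {M : Type*} [Monoid M] {r₁ r₂ r₃ a₁ a₂ b₂ b₃ : M}
    (h : r₁ * r₂ * r₃ = r₃ * r₂ * r₁) (h₁ : b₂ * r₁ * a₁ = a₁ * r₁ * b₂)
    (h₂ : b₃ * r₂ * a₁ = a₁ * r₂ * b₃) (h₃ : b₃ * r₃ * a₂ = a₂ * r₃ * b₃)
    (hba : b₂ * a₂ = 1) (hab : a₂ * b₂ = 1) (hb₃ : b₃ * r₁ = r₁ * b₃) (hb₂ : b₂ * r₂ = r₂ * b₂)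
    (ha₁ : a₁ * r₃ = r₃ * a₁) (k₁ : a₁ * b₃ = b₃ * a₁) (k₂ : b₂ * b₃ = b₃ * b₂)
    (k₃ : b₂ * a₁ = a₁ * b₂) :
    b₂ * r₁ * a₁ * (b₃ * r₂ * a₁) * (b₃ * r₃ * a₂) =
      b₃ * r₃ * a₂ * (b₃ * r₂ * a₁) * (b₂ * r₁ * a₁) := by
  -- The middle operator acts on factors 1 and 3 only, so `b₂` passes through it and meets `a₂`,
  -- which it cancels.
  have hX : b₂ * (b₃ * r₂ * a₁) = b₃ * r₂ * a₁ * b₂ :=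
    (Commute.mul_right (Commute.mul_right k₂ hb₂) k₃ : Commute b₂ _)
  calc b₂ * r₁ * a₁ * (b₃ * r₂ * a₁) * (b₃ * r₃ * a₂)
      = a₁ * r₁ * (b₂ * (b₃ * r₂ * a₁)) * (a₂ * r₃ * b₃) := by
        rw [h₁, h₃]; simp only [mul_assoc]
    _ = a₁ * (r₁ * b₃) * r₂ * a₁ * (b₂ * a₂) * r₃ * b₃ := by rw [hX]; simp only [mul_assoc]
    _ = a₁ * b₃ * r₁ * r₂ * (a₁ * r₃) * b₃ := by rw [hba, ← hb₃]; simp only [mul_assoc, one_mul]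
    _ = a₁ * b₃ * (r₁ * r₂ * r₃) * (a₁ * b₃) := by rw [ha₁]; simp only [mul_assoc]
    _ = b₃ * (a₁ * r₃) * r₂ * r₁ * (b₃ * a₁) := by rw [h, k₁]; simp only [mul_assoc]
    _ = b₃ * r₃ * a₁ * r₂ * (b₃ * r₁) * a₁ := by rw [ha₁, hb₃]; simp only [mul_assoc]
    _ = b₃ * r₃ * (a₂ * b₂) * (a₁ * r₂ * b₃) * r₁ * a₁ := by
        rw [hab]; simp only [mul_assoc, one_mul]
    _ = b₃ * r₃ * a₂ * (b₂ * (b₃ * r₂ * a₁)) * r₁ * a₁ := by rw [h₂]; simp only [mul_assoc]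
    _ = b₃ * r₃ * a₂ * (b₃ * r₂ * a₁) * (b₂ * r₁ * a₁) := by rw [hX]; simp only [mul_assoc]

theorem IsQYBE.twist {R : Module.End k (V ⊗[k] V)} (hR : IsQYBE R) {A C : Module.End k V}
    (hAC : A * C = 1) (hCA : C * A = 1) (hA : R * map A A = map A A * R) :
    IsQYBE (map LinearMap.id C * R * map A LinearMap.id) := by
  have hm : ∀ X Y Z W : Module.End k V, map X Y * map Z W = map (X * Z) (Y * W) :=
    fun X Y Z W => (TensorProduct.map_mul X Z Y W).symm
  have h1 : ∀ X : Module.End k V, LinearMap.id * X = X := fun X => rfl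
  have h1' : ∀ X : Module.End k V, X * LinearMap.id = X := fun X => rfl
  -- The twist has two forms: write `A ⊗ 1 = (A ⊗ A)(1 ⊗ C)`, move `A ⊗ A` to the left of `R`, and
  -- absorb `1 ⊗ C` into it there. In the three positions this yields the hypotheses `h₁`, `h₂`,
  -- `h₃` of `yangBaxter_twist`.
  have e : map LinearMap.id C * R * map A LinearMap.id =
      map A LinearMap.id * R * map LinearMap.id C := by
    have h2 : map A LinearMap.id = map A A * map LinearMap.id C := by
      rw [hm, h1', hAC]; rfl
    have h3 : map LinearMap.id C * map A A = map A LinearMap.id := by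
      rw [hm, h1, hCA]; rfl
    rw [h2, mul_assoc, ← mul_assoc R, hA, ← mul_assoc, ← mul_assoc, h3, ← h2]
  have cancel : map LinearMap.id (map C LinearMap.id) * map LinearMap.id (map A LinearMap.id) =
      (1 : Module.End k (V ⊗[k] (V ⊗[k] V))) := by
    refine end_ext_threefold fun x y z => ?_
    simpa using congrArg (fun w => x ⊗ₜ[k] (w ⊗ₜ[k] z)) (LinearMap.congr_fun hCA y)
  have cancel' : map LinearMap.id (map A LinearMap.id) * map LinearMap.id (map C LinearMap.id) =
      (1 : Module.End k (V ⊗[k] (V ⊗[k] V))) := by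
    refine end_ext_threefold fun x y z => ?_
    simpa using congrArg (fun w => x ⊗ₜ[k] (w ⊗ₜ[k] z)) (LinearMap.congr_fun hAC y)
  have c12 : ∀ X Y : Module.End k V, (map X (map LinearMap.id LinearMap.id) *
      map LinearMap.id (map LinearMap.id Y) : Module.End k (V ⊗[k] (V ⊗[k] V))) =
      map LinearMap.id (map LinearMap.id Y) * map X (map LinearMap.id LinearMap.id) := by
    intro X Y
    refine end_ext_threefold fun x y z => ?_
    simp
  have c23 : ∀ X Y : Module.End k V, (map LinearMap.id (map X LinearMap.id) *
      map LinearMap.id (map LinearMap.id Y) : Module.End k (V ⊗[k] (V ⊗[k] V))) =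
      map LinearMap.id (map LinearMap.id Y) * map LinearMap.id (map X LinearMap.id) := by
    intro X Y
    refine end_ext_threefold fun x y z => ?_
    simp
  have c13 : ∀ X Y : Module.End k V, (map LinearMap.id (map X LinearMap.id) *
      map Y (map LinearMap.id LinearMap.id) : Module.End k (V ⊗[k] (V ⊗[k] V))) =
      map Y (map LinearMap.id LinearMap.id) * map LinearMap.id (map X LinearMap.id) := by
    intro X Y
    refine end_ext_threefold fun x y z => ?_
    simp
  have f1 := firstTwo_map A (LinearMap.id : Module.End k V)
  have f2 := firstTwo_map (LinearMap.id : Module.End k V) C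
  have o1 := outerTwo_map A (LinearMap.id : Module.End k V)
  have o3 := outerTwo_map (LinearMap.id : Module.End k V) C
  have l2 := lastTwo_map A (LinearMap.id : Module.End k V)
  have l3 := lastTwo_map (LinearMap.id : Module.End k V) C
  rw [isQYBE_iff] at hR ⊢
  have F := congrArg firstTwo e
  have O := congrArg outerTwo e
  have L := congrArg lastTwo e
  simp only [map_mul, f1, f2, o1, o3, l2, l3] at F O L ⊢
  exact yangBaxter_twist hR F O L cancel cancel' (firstTwo_comm R C) (outerTwo_comm R C)
    (lastTwo_comm R A) (c12 A C) (c23 C C) (c13 C A)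

theorem ybOperator_eq (v : Module.Basis (Fin n) k V) (q : kˣ) (i : Fin n) :
    ybOperator v q (v i ⊗ₜ v i) = (q : k) • (v i ⊗ₜ v i) := by
  rw [ybOperator, ← Module.Basis.tensorProduct_apply, Module.Basis.constr_basis]
  simp

theorem ybOperator_lt (v : Module.Basis (Fin n) k V) (q : kˣ) {i j : Fin n} (h : i < j) :
    ybOperator v q (v i ⊗ₜ v j) = v i ⊗ₜ v j := by
  rw [ybOperator, ← Module.Basis.tensorProduct_apply, Module.Basis.constr_basis]
  simp [h, h.ne]

theorem ybOperator_gt (v : Module.Basis (Fin n) k V) (q : kˣ) {i j : Fin n} (h : j < i) :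
    ybOperator v q (v i ⊗ₜ v j) =
      v i ⊗ₜ v j + ((q : k) - ((q⁻¹ : kˣ) : k)) • (v j ⊗ₜ v i) := by
  rw [ybOperator, ← Module.Basis.tensorProduct_apply, Module.Basis.constr_basis]
  simp [h.not_gt, h.ne']

theorem firstTwo_tmul (R : Module.End k (V ⊗[k] V)) (x y z : V) :
    firstTwo R (x ⊗ₜ (y ⊗ₜ z)) = TensorProduct.assoc k V V V (R (x ⊗ₜ y) ⊗ₜ z) := rfl

theorem outerTwo_tmul (R : Module.End k (V ⊗[k] V)) (x y z : V) :
    outerTwo R (x ⊗ₜ (y ⊗ₜ z)) =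
      swapLast (TensorProduct.assoc k V V V (R (x ⊗ₜ z) ⊗ₜ y)) := rfl

theorem lastTwo_tmul (R : Module.End k (V ⊗[k] V)) (x y z : V) :
    lastTwo R (x ⊗ₜ (y ⊗ₜ z)) = x ⊗ₜ R (y ⊗ₜ z) := rfl

theorem swapLast_tmul (x y z : V) :
    swapLast (x ⊗ₜ[k] (y ⊗ₜ[k] z)) = x ⊗ₜ (z ⊗ₜ y) := rfl

/-- A check on basis vectors, one case for each relative order of the three indices. -/
theorem isQYBE_ybOperator (v : Module.Basis (Fin n) k V) (q : kˣ) : IsQYBE (ybOperator v q) := by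
  rw [isQYBE_iff]
  refine (v.tensorProduct (v.tensorProduct v)).ext fun p => ?_
  obtain ⟨i, j, l⟩ := p
  simp only [Module.Basis.tensorProduct_apply, Module.End.mul_apply]
  -- The Hecke relation `q² = 1 + q (q - q⁻¹)`. Once `q - q⁻¹` is generalized to `c`, it is the only
  -- relation kept between the two scalars.
  have hq : (q : k) * (q : k) = 1 + (q : k) * ((q : k) - ((q⁻¹ : kˣ) : k)) := by
    rw [mul_sub, Units.mul_inv]; ring
  have he := ybOperator_eq v q
  have hl : ∀ i j : Fin n, i < j → _ := fun i j => ybOperator_lt v q (i := i) (j := j)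
  have hg : ∀ i j : Fin n, j < i → _ := fun i j => ybOperator_gt v q (i := i) (j := j)
  generalize (q : k) - ((q⁻¹ : kˣ) : k) = c at *
  rcases lt_trichotomy i j with h1 | h1 | h1 <;> rcases lt_trichotomy j l with h2 | h2 | h2 <;>
    rcases lt_trichotomy i l with h3 | h3 | h3 <;>
    first
    -- Removes the inconsistent combinations of the three comparisons.
    | (exfalso; order)
    | (try subst h1
       try subst h2
       try subst h3
       simp only [firstTwo_tmul, outerTwo_tmul, lastTwo_tmul, swapLast_tmul, *, -hq,
        TensorProduct.add_tmul, TensorProduct.tmul_add, TensorProduct.assoc_tmul, map_add,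
        map_smul, ← TensorProduct.smul_tmul', TensorProduct.tmul_smul] <;>
       match_scalars <;> grind)

end YangBaxter

/-! ### Scalar solutions of the relations of `A(R_q)`. -/

section FRT
variable {k : Type*} [Field k] {n : ℕ}

open scoped Kronecker

/-- For commuting entries the relation with indices `u, v, a, b` is the entry of this matrix
identity in row `(a, b)` and column `(v, u)`. -/
theorem IsFRT.mul_kronecker {R : Matrix (Fin n × Fin n) (Fin n × Fin n) k}
    {α : Matrix (Fin n) (Fin n) k} (h : IsFRT R α) : R * (α ⊗ₖ α) = (α ⊗ₖ α) * R := by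
  ext ⟨a, b⟩ ⟨v, u⟩
  have := h u v a b
  simp only [smul_eq_mul] at this
  simp only [Matrix.mul_apply, Matrix.kronecker_apply, Fintype.sum_prod_type]
  calc _ = _ := Finset.sum_congr rfl fun i _ => Finset.sum_congr rfl fun j _ => by ring
    _ = _ := this
    _ = _ := Finset.sum_congr rfl fun i _ => Finset.sum_congr rfl fun j _ => by ring

theorem rqMatrix_one (q : kˣ) (hq : (q : k) = 1) : rqMatrix n q = 1 := by
  obtain rfl : q = 1 := Units.ext hq
  ext c d
  by_cases h : c = d <;> simp [rqMatrix, h, Matrix.one_apply]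

theorem rqMatrix_neg_one (q : kˣ) (hq : (q : k) = -1) (c d : Fin n × Fin n) :
    rqMatrix n q c d = if c = d then (if d.1 = d.2 then -1 else 1) else 0 := by
  obtain rfl : q = -1 := Units.ext hq
  by_cases h : c = d <;> by_cases h' : d.1 = d.2 <;> simp [rqMatrix, h, h']

variable {q : kˣ} {α β : Matrix (Fin n) (Fin n) k}

theorem IsFRT.mul_eq_zero_of_row (h : IsFRT (rqMatrix n q) α) (hq : (q : k) ≠ 1) (a : Fin n)
    {u v : Fin n} (huv : u ≠ v) : α a u * α a v = 0 := by
  -- In this order the term with `q - q⁻¹` is absent, and the relation reads `(q - 1) α a u α a v =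
  -- 0`.
  wlog hlt : u < v generalizing u v
  · rw [mul_comm]
    exact this huv.symm (lt_of_le_of_ne (not_lt.1 hlt) huv.symm)
  have := h v u a a
  rw [rq_sum_left, rq_sum_right] at this
  simp only [if_true, huv, if_false, hlt.not_gt, smul_eq_mul, add_zero] at this
  have h0 : ((q : k) - 1) * (α a u * α a v) = 0 := by linear_combination this
  exact (mul_eq_zero.1 h0).resolve_left (sub_ne_zero.2 hq)

theorem IsFRT.mul_eq_zero_of_col (h : IsFRT (rqMatrix n q) α) (hq : (q : k) ≠ 1) (u : Fin n)
    {a b : Fin n} (hab : a ≠ b) : α a u * α b u = 0 := by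
  wlog hlt : b < a generalizing a b
  · rw [mul_comm]
    exact this hab.symm (lt_of_le_of_ne (not_lt.1 hlt) hab)
  have := h u u a b
  rw [rq_sum_left, rq_sum_right] at this
  simp only [if_true, hab, if_false, hlt.not_gt, smul_eq_mul, add_zero] at this
  have h0 : ((q : k) - 1) * (α a u * α b u) = 0 := by linear_combination -this
  exact (mul_eq_zero.1 h0).resolve_left (sub_ne_zero.2 hq)

/-- Because scalars commute, the two main terms of the relation cancel and `(q - q⁻¹) α a v α b u =
0` remains; multiplying by `q` gives the factor `(q - 1)(q + 1)`. -/
theorem IsFRT.mul_eq_zero_of_lt (h : IsFRT (rqMatrix n q) α) (hq : (q : k) ≠ 1)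
    (hq' : (q : k) ≠ -1) {a b u v : Fin n} (hab : a < b) (huv : u < v) : α a v * α b u = 0 := by
  have := h v u a b
  rw [rq_sum_left, rq_sum_right] at this
  simp only [hab.ne, hab, huv.ne, huv.not_gt, if_true, if_false, smul_eq_mul, add_zero] at this
  have hu : (q : k) * ((q⁻¹ : kˣ) : k) = 1 := Units.mul_inv q
  have h0 : ((q : k) - 1) * ((q + 1) * (α a v * α b u)) = 0 := by
    linear_combination (q : k) * this + (α a v * α b u) * hu
  exact (mul_eq_zero.1 ((mul_eq_zero.1 h0).resolve_left (sub_ne_zero.2 hq))).resolve_left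
    fun e => hq' (eq_neg_of_add_eq_zero_left e)

/-- An invertible scalar solution of the relations of `A(R_q)` is a generalized permutation
matrix. -/
theorem IsFRT.exists_perm (h : IsFRT (rqMatrix n q) α) (hq : (q : k) ≠ 1) (hαβ : α * β = 1) :
    ∃ τ : Equiv.Perm (Fin n), ∀ i j, α i j ≠ 0 ↔ j = τ i := by
  have hrow : ∀ i, ∃ j, α i j ≠ 0 := by
    intro i
    by_contra! hi
    have := congrFun (congrFun hαβ i) i
    simp [Matrix.mul_apply, hi] at this
  choose f hf using hrow
  have hf' : ∀ i j, α i j ≠ 0 ↔ j = f i := by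
    refine fun i j => ⟨fun hij => ?_, fun e => e ▸ hf i⟩
    by_contra hne
    exact mul_ne_zero hij (hf i) (h.mul_eq_zero_of_row hq i hne)
  have hinj : Function.Injective f := by
    intro a b e
    by_contra hne
    exact mul_ne_zero (hf a) (e ▸ hf b) (h.mul_eq_zero_of_col hq (f a) hne)
  exact ⟨Equiv.ofBijective f (Finite.injective_iff_bijective.1 hinj), hf'⟩

theorem IsFRT.apply_eq_zero (h : IsFRT (rqMatrix n q) α) (hq : (q : k) ≠ 1)
    (hq' : (q : k) ≠ -1) (hαβ : α * β = 1) {i j : Fin n} (hij : i ≠ j) :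
    α i j = 0 := by
  obtain ⟨τ, hτ⟩ := h.exists_perm hq hαβ
  -- An inversion of `τ` would give two nonzero entries whose product vanishes by
  -- `mul_eq_zero_of_lt`. The only order automorphism of `Fin n` is the identity.
  have hmono : StrictMono τ := by
    intro a b hab
    by_contra hlt
    have hlt' : τ b < τ a := lt_of_le_of_ne (not_lt.1 hlt) fun e => hab.ne' (τ.injective e)
    exact mul_ne_zero ((hτ a _).2 rfl) ((hτ b _).2 rfl) (h.mul_eq_zero_of_lt hq hq' hab hlt')
  have hid : τ i = i := by
    have : (hmono.orderIsoOfSurjective τ τ.surjective) = OrderIso.refl _ := Subsingleton.elim _ _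
    exact DFunLike.congr_fun this i
  by_contra h0
  exact hij (hid ▸ (hτ i j).1 h0).symm

/-- Row `τ⁻¹ b` of `α` has its only nonzero entry in column `b`, so that row of `α β = 1` determines
row `b` of `β`. -/
theorem inv_apply_eq {τ : Equiv.Perm (Fin n)} (hτ : ∀ i j, α i j ≠ 0 ↔ j = τ i)
    (hαβ : α * β = 1) (b j : Fin n) :
    β b j = if b = τ j then (α j b)⁻¹ else 0 := by
  have h0 : ∀ i j, j ≠ τ i → α i j = 0 := fun i j hij => not_not.1 (mt (hτ i j).1 hij)
  have h1 := congrFun (congrFun hαβ (τ.symm b)) j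
  rw [Matrix.mul_apply, Finset.sum_eq_single b (fun c _ hc => by
    rw [h0 _ _ (by simpa using hc), zero_mul]) (by simp), Matrix.one_apply] at h1
  have hb : α (τ.symm b) b ≠ 0 := (hτ _ _).2 (by simp)
  split_ifs with hbj
  · subst hbj
    simp only [Equiv.symm_apply_apply, if_true] at h1 hb
    exact eq_inv_of_mul_eq_one_right h1
  · rw [if_neg fun e => hbj (by rw [← e, Equiv.apply_symm_apply])] at h1
    exact (mul_eq_zero.1 h1).resolve_left hb

end FRT

/-! ### From matrices of coefficients to operators. -/

section Coefficients
variable {k : Type*} [Field k] {V : Type*} [AddCommGroup V] [Module k V] {n : ℕ}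

open scoped Kronecker

theorem coeffs_map (v : Module.Basis (Fin n) k V) (A C : Matrix (Fin n) (Fin n) k) :
    coeffs v (TensorProduct.map (Matrix.toLin v v A) (Matrix.toLin v v C)) = A ⊗ₖ C := by
  rw [coeffs, TensorProduct.toMatrix_map, LinearMap.toMatrix_toLin, LinearMap.toMatrix_toLin]

theorem coeffs_mul (v : Module.Basis (Fin n) k V) (R S : Module.End k (V ⊗[k] V)) :
    coeffs v (R * S) = coeffs v R * coeffs v S :=
  LinearMap.toMatrix_mul _ _ _

theorem coeffs_injective (v : Module.Basis (Fin n) k V) :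
    Function.Injective (coeffs v : Module.End k (V ⊗[k] V) → _) :=
  (LinearMap.toMatrix _ _).injective

/-- The hypothesis `hS` is `S = (1 ⊗ β) R (α ⊗ 1)` in coordinates, which puts `S` in the form
treated by `IsQYBE.twist`. -/
theorem isQYBE_of_coeffs (v : Module.Basis (Fin n) k V) {R S : Module.End k (V ⊗[k] V)}
    (hR : IsQYBE R) {α β : Matrix (Fin n) (Fin n) k} (hαβ : α * β = 1) (hβα : β * α = 1)
    (hα : IsFRT (coeffs v R) α)
    (hS : ∀ a b i j, coeffs v S (a, b) (i, j) =
      ∑ w, ∑ p, β b w * coeffs v R (a, w) (p, j) * α p i) : IsQYBE S := by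
  have h := hR.twist (A := Matrix.toLin v v α) (C := Matrix.toLin v v β)
    (by rw [Module.End.mul_eq_comp, ← Matrix.toLin_mul, hαβ, Matrix.toLin_one]; rfl)
    (by rw [Module.End.mul_eq_comp, ← Matrix.toLin_mul, hβα, Matrix.toLin_one]; rfl)
    (coeffs_injective v (by rw [coeffs_mul, coeffs_mul, coeffs_map, hα.mul_kronecker]))
  convert h
  apply coeffs_injective v
  rw [coeffs_mul, coeffs_mul, ← Matrix.toLin_one v, coeffs_map, coeffs_map]
  ext ⟨a, b⟩ ⟨i, j⟩
  rw [hS, Finset.sum_comm]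
  simp [Matrix.mul_apply, Fintype.sum_prod_type, Matrix.one_apply, Finset.sum_mul]

end Coefficients

/-! ### The grading, the automorphisms and the twist on `A(R_q)[g⁻¹]`. -/

namespace QuantumGL
variable {k : Type*} [Field k] {n : ℕ} {q : kˣ}

open Coalgebra

theorem range_map_mul_mem {m p : ℤ} {x y : QuantumGL k n q ⊗[k] QuantumGL k n q}
    (hx : x ∈ LinearMap.range
      (TensorProduct.map (grading k n q m).subtype (grading k n q m).subtype))
    (hy : y ∈ LinearMap.range
      (TensorProduct.map (grading k n q p).subtype (grading k n q p).subtype)) :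
    x * y ∈ LinearMap.range
      (TensorProduct.map (grading k n q (m + p)).subtype (grading k n q (m + p)).subtype) := by
  obtain ⟨z, rfl⟩ := hx
  obtain ⟨w, rfl⟩ := hy
  induction z with
  | zero => simp
  | add z z' h h' => rw [map_add, add_mul]; exact add_mem h h'
  | tmul a b =>
    induction w with
    | zero => simp
    | add w w' h h' => rw [map_add, mul_add]; exact add_mem h h'
    | tmul c d =>
      exact ⟨⟨a * c, SetLike.mul_mem_graded a.2 c.2⟩ ⊗ₜ ⟨b * d, SetLike.mul_mem_graded b.2 d.2⟩,
        (Algebra.TensorProduct.tmul_mul_tmul (R := k) a.1 c.1 b.1 d.1).symm⟩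

theorem comul_gen_mem (x : Option (Fin n × Fin n)) :
    comul (R := k) (gen k n q x) ∈ LinearMap.range (TensorProduct.map
      (grading k n q (genDegree n x)).subtype (grading k n q (genDegree n x)).subtype) := by
  cases x with
  | none =>
    exact (comul_gInv (k := k) (n := n) (q := q)).symm ▸
      ⟨⟨_, gen_mem none⟩ ⊗ₜ ⟨_, gen_mem none⟩, rfl⟩
  | some p =>
    refine (comul_t (k := k) (n := n) (q := q) p.1 p.2).symm ▸ Submodule.sum_mem _ fun l _ => ?_
    exact ⟨⟨_, gen_mem (some (p.1, l))⟩ ⊗ₜ ⟨_, gen_mem (some (l, p.2))⟩, rfl⟩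

/-- `Δ` is multiplicative and each component is spanned by monomials, so it suffices that `Δ` of a
generator has both legs in the degree of that generator. -/
theorem isCoalgebraGrading : IsCoalgebraGrading (grading k n q) := by
  intro m x hx
  induction hx using Submodule.span_induction with
  | mem x hx =>
    obtain ⟨l, rfl, rfl⟩ := hx
    induction l with
    | nil =>
      simp only [List.map_nil, List.prod_nil, Bialgebra.comul_one]
      exact ⟨⟨1, SetLike.GradedOne.one_mem⟩ ⊗ₜ ⟨1, SetLike.GradedOne.one_mem⟩, rfl⟩
    | cons a l ih =>
      simp only [List.map_cons, List.prod_cons, Bialgebra.comul_mul]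
      exact range_map_mul_mem (comul_gen_mem a) ih
  | zero => simp
  | add x y _ _ hx hy => rw [map_add]; exact add_mem hx hy
  | smul c x _ hx => rw [map_smul]; exact Submodule.smul_mem _ c hx

noncomputable def reprT (j i : Fin n) : Repr k (t k n q j i) (Fin n) where
  index := Finset.univ
  left l := t k n q j l
  right l := t k n q l i
  eq := (comul_t j i).symm

/-- The matrix of values of `ε φ` at the generators. -/
noncomputable def counitMatrix (φ : QuantumGL k n q ≃ₐ[k] QuantumGL k n q) :
    Matrix (Fin n) (Fin n) k :=
  Matrix.of fun j i => counit (R := k) (φ (t k n q j i))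

/-- `εφ` is an algebra homomorphism to `k`, and it carries the defining relations to scalar ones. -/
theorem isFRT_counitMatrix (φ : QuantumGL k n q ≃ₐ[k] QuantumGL k n q) :
    IsFRT (rqMatrix n q) (counitMatrix φ) :=
  isFRT_t.map ((Bialgebra.counitAlgHom k _).comp φ.toAlgHom)

theorem apply_t_of_mem {φ : QuantumGL k n q ≃ₐ[k] QuantumGL k n q} (hφ : φ ∈ comulAut k _)
    (j i : Fin n) : φ (t k n q j i) = ∑ u, counitMatrix φ j u • t k n q u i :=
  (sum_counit_smul_of_mem hφ (reprT j i)).symm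

theorem counitMatrix_mul {φ : QuantumGL k n q ≃ₐ[k] QuantumGL k n q} (hφ : φ ∈ comulAut k _)
    (ψ : QuantumGL k n q ≃ₐ[k] QuantumGL k n q) :
    counitMatrix φ * counitMatrix ψ = counitMatrix (ψ * φ) := by
  ext j i
  exact sum_counit_mul_counit hφ ψ (reprT j i)

theorem counitMatrix_one : counitMatrix (1 : QuantumGL k n q ≃ₐ[k] QuantumGL k n q) = 1 := by
  ext j i
  exact counit_t j i

/-- Here `φ` acts on the right legs of `Δ`, so the counit is applied on the right and the matrix
mixes lower indices instead of upper ones. -/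
theorem apply_t_of_comul_left {φ : QuantumGL k n q ≃ₐ[k] QuantumGL k n q}
    (hφ : comul ∘ₗ φ.toLinearMap = φ.toLinearMap.lTensor _ ∘ₗ
      (comul : QuantumGL k n q →ₗ[k] QuantumGL k n q ⊗[k] QuantumGL k n q))
    (j i : Fin n) : φ (t k n q j i) = ∑ u, counitMatrix φ u i • t k n q j u := by
  have h : comul (R := k) (φ (t k n q j i)) = ∑ l, t k n q j l ⊗ₜ[k] φ (t k n q l i) := by
    rw [← AlgEquiv.toLinearMap_apply, ← LinearMap.comp_apply, hφ, LinearMap.comp_apply, comul_t,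
      map_sum]
    rfl
  have h' := congrArg (fun z => TensorProduct.rid k _ (counit.lTensor _ z)) h
  simp only [lTensor_counit_comul, map_sum, LinearMap.lTensor_tmul, TensorProduct.rid_tmul,
    one_smul] at h'
  exact h'

/-- In degree 1 one has `σ(t^a_u, t^b_w) = δ^a_u εφ(t^b_w)`, and `σ⁻¹` has the same shape with
`φ⁻¹`. The two deltas remove the sums over `u` and `r`. -/
theorem twistMatrix_twistForm {φ : QuantumGL k n q ≃ₐ[k] QuantumGL k n q}
    (hφ : φ ∈ comulAut k _) (R : Matrix (Fin n × Fin n) (Fin n × Fin n) k) (a b i j : Fin n) :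
    twistMatrix (t k n q) R (twistForm (grading k n q) φ) (a, b) (i, j) =
      ∑ w, ∑ p, counitMatrix φ b w * R (a, w) (p, j) * counitMatrix φ⁻¹ p i := by
  have ht : ∀ j i, t k n q j i ∈ grading k n q 1 := fun j i => gen_mem (some (j, i))
  rw [twistMatrix, Matrix.of_apply, convInv_twistForm isCoalgebraGrading φ hφ]
  simp only [twistForm_apply _ _ (ht _ _), counit_t, zpow_one]
  rw [Finset.sum_eq_single a (by intro u _ hu; simp [hu.symm]) (by simp)]
  refine Finset.sum_congr rfl fun w _ => Finset.sum_congr rfl fun p _ => ?_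
  rw [Finset.sum_eq_single j (by intro r _ hr; simp [hr]) (by simp)]
  simp [counitMatrix]

end QuantumGL

end TwistR

open TwistR TwistR.QuantumGL in
theorem mainTheorem6 {k : Type*} [Field k] {V : Type*} [AddCommGroup V] [Module k V] {n : ℕ}
    (hn : 2 ≤ n) (v : Module.Basis (Fin n) k V) (q : kˣ)
    (φ₁ φ₂ : TwistR.QuantumGL k n q ≃ₐ[k] TwistR.QuantumGL k n q) (hφ : TwistR.IsTwistingPair φ₁ φ₂)
    (σ : TwistR.QuantumGL k n q ⊗[k] TwistR.QuantumGL k n q →ₗ[k] k)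
    (hσ : σ = TwistR.twistForm (TwistR.QuantumGL.grading k n q) φ₂)
    (Rσ : Module.End k (V ⊗[k] V))
    (hRσ : Rσ = TwistR.twistOperator v (TwistR.QuantumGL.t k n q) (TwistR.ybOperator v q) σ) :
    TwistR.IsTwoCocycle σ ∧ TwistR.IsQYBE Rσ ∧
    ∃ α β : Matrix (Fin n) (Fin n) k, α * β = 1 ∧ β * α = 1 ∧
      (∀ i j, φ₁ (TwistR.QuantumGL.t k n q j i) = ∑ u, α u i • TwistR.QuantumGL.t k n q j u) ∧
      (∀ i j, φ₂ (TwistR.QuantumGL.t k n q j i) = ∑ u, β j u • TwistR.QuantumGL.t k n q u i) ∧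
      ((q : k) = 1 → ∀ a b i j, TwistR.coeffs v Rσ (a, b) (i, j) = α a i * β b j) ∧
      ((q : k) = -1 → ringChar k ≠ 2 → ∃ τ : Equiv.Perm (Fin n),
        (∀ i j, α i j ≠ 0 ↔ j = τ i) ∧
        ∀ a b i j, TwistR.coeffs v Rσ (a, b) (i, j) =
          (-1) ^ (if j = a then 1 else 0) * (if a = τ.symm i then 1 else 0) *
            (if b = τ j then 1 else 0) * α a i * (α j b)⁻¹) ∧
      ((q : k) ≠ 1 → (q : k) ≠ -1 →
        (∀ i j, i ≠ j → α i j = 0) ∧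
        ∀ a b i j, TwistR.coeffs v Rσ (a, b) (i, j) =
          TwistR.coeffs v (TwistR.ybOperator v q) (a, b) (i, j) * α i i * (α b b)⁻¹) := by
  have hφ₂ : φ₂ ∈ comulAut k _ := mem_comulAut.2 hφ.comul_right
  have hβα : counitMatrix φ₂ * counitMatrix φ₁ = 1 := by
    rw [counitMatrix_mul hφ₂, ← counitMatrix_one]
    ext j i
    exact LinearMap.congr_fun hφ.counit _
  have hαβ : counitMatrix φ₁ * counitMatrix φ₂ = 1 := mul_eq_one_comm.1 hβα
  -- Both matrices are inverse to `counitMatrix φ₂`, so `φ₂⁻¹` and `φ₁` agree under `ε` on the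
  -- generators.
  have hα : counitMatrix φ₂⁻¹ = counitMatrix φ₁ := by
    have h : counitMatrix φ₂ * counitMatrix φ₂⁻¹ = 1 := by
      rw [counitMatrix_mul hφ₂, inv_mul_cancel, counitMatrix_one]
    rw [← one_mul (counitMatrix φ₂⁻¹), ← hαβ, mul_assoc, h, mul_one]
  have hfrt := isFRT_counitMatrix φ₁
  have hcoef : ∀ a b i j, coeffs v Rσ (a, b) (i, j) = ∑ w, ∑ p,
      counitMatrix φ₂ b w * rqMatrix n q (a, w) (p, j) * counitMatrix φ₁ p i := by
    intro a b i j
    rw [hRσ, hσ, twistOperator, coeffs, LinearMap.toMatrix_toLin, twistMatrix_twistForm hφ₂,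
      coeffs_ybOperator, hα]
  subst hσ
  refine ⟨isTwoCocycle_twistForm isCoalgebraGrading φ₂ hφ₂,
    isQYBE_of_coeffs v (isQYBE_ybOperator v q) hαβ hβα (by rwa [coeffs_ybOperator])
      (by rwa [coeffs_ybOperator]),
    counitMatrix φ₁, counitMatrix φ₂, hαβ, hβα, fun i j => apply_t_of_comul_left hφ.comul_left j i,
    fun i j => apply_t_of_mem hφ₂ j i, ?_, ?_, ?_⟩
  · intro hq a b i j
    rw [hcoef, rqMatrix_one q hq, Finset.sum_eq_single j, Finset.sum_eq_single a]
    · simp [mul_comm]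
    · intro p _ hp
      simp [hp.symm]
    · simp
    · intro w _ hw
      simp [hw]
    · simp
  · intro hq hchar
    -- The characteristic enters only here, to separate `-1` from `1`.
    have hq1 : (q : k) ≠ 1 := hq ▸ Ring.neg_one_ne_one_of_char_ne_two hchar
    obtain ⟨τ, hτ⟩ := hfrt.exists_perm hq1 hαβ
    refine ⟨τ, hτ, fun a b i j => ?_⟩
    -- `R_{-1}` is diagonal, which forces `w = j` and `p = a`; its diagonal entry supplies the sign.
    rw [hcoef, Finset.sum_eq_single j, Finset.sum_eq_single a]
    · have hz : a ≠ τ.symm i → counitMatrix φ₁ a i = 0 := fun h =>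
        not_not.1 (mt (hτ a i).1 fun e => h (by rw [e, Equiv.symm_apply_apply]))
      rw [rqMatrix_neg_one q hq, inv_apply_eq hτ hαβ]
      by_cases h : a = τ.symm i
      · by_cases h' : j = a
        · simp only [h', if_true, if_pos h]
          split_ifs <;> ring
        · have h'' : ¬ a = j := fun e => h' e.symm
          simp only [h', h'', if_false, if_true, if_pos h]
          split_ifs <;> ring
      · simp [hz h]
    · intro p _ hp
      simp [rqMatrix_neg_one q hq, hp.symm]
    · simp
    · intro w _ hw
      simp [rqMatrix_neg_one q hq, hw]
    · simp
  · intro hq hq'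
    have hdiag : ∀ i j, i ≠ j → counitMatrix φ₁ i j = 0 :=
      fun i j hij => hfrt.apply_eq_zero hq hq' hαβ hij
    -- Diagonality is restated as a generalized permutation with trivial permutation, so that
    -- `inv_apply_eq` gives the entries of `β`.
    have hτ : ∀ i j, counitMatrix φ₁ i j ≠ 0 ↔ j = Equiv.refl (Fin n) i := by
      obtain ⟨τ, hτ⟩ := hfrt.exists_perm hq hαβ
      have hid : τ = Equiv.refl _ := Equiv.ext fun i => by
        by_contra hne
        exact (hτ i (τ i)).2 rfl (hdiag _ _ (Ne.symm hne))
      rwa [hid] at hτ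
    refine ⟨hdiag, fun a b i j => ?_⟩
    -- Now `α` and `β` are the diagonal factors, so `w = b` and `p = i` while `R_q` is untouched.
    rw [hcoef, coeffs_ybOperator, Finset.sum_eq_single b, Finset.sum_eq_single i]
    · simp only [inv_apply_eq hτ hαβ, Equiv.refl_apply, if_true]
      ring
    · intro p _ hp
      simp [hdiag p i hp]
    · simp
    · intro w _ hw
      simp [inv_apply_eq hτ hαβ, hw.symm]
    · simp
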